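/- Let $q\ge 2$, $K=\{0,1,\dots,q-1\}$, and let $E=[E_{bc}]_{b,c\in K}$ be a row-stochastic matrix with smallest entry $p$ and largest entry $P$ satisfying $0<p\le P<1$. Let $\epsilon_0=1$ and $0<\epsilon_a<1$ for $a=1,\dots,q-1$. Let $(X_i)_{i\in\mathbb Z}$ be a stationary Markov chain on $K$ with transition matrix $E$, and let $(Y_i)_{i\in\mathbb Z}$ be its observation through the memoryless channel in which $0$ is always received as $0$, and a symbol $a\ne 0$ is received as $0$ with probability $\epsilon_a$ and as $a$ with probability $1-\epsilon_a$. Let $\mu$ be the law of $(Y_i)$ on $K^{\mathbb Z}$ and $$H(\mu)=\lim_{n\to\infty}\frac{S_n}{n},\qquad S_n=-\sum_{w\in K^n}\mu(w)\log_2\mu(w),$$ its entropy rate, where $\mu(w)=\Pr[(Y_1,\dots,Y_n)=w]$. Notation: $\sigma$ is the all-ones vector; $E_0$ is the matrix with rows $\epsilon_b E_{b\,\cdot}$ $(b\in K)$; for $a\ne0$, $E_a$ is the matrix whose only nonzero row is its $a$-th row, $(1-\epsilon_a)E_{a\,\cdot}$. Let $e_j$ be the $j$-th row of $E$ (rows are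 numbered from $0$) as a column vector, $\Gamma_0\nu=E_0^{*}\nu/\langle\nu,E_0\sigma\rangle$, $h_a(w)=-\langle w,E_a\sigma\rangle\log_2\langle w,E_a\sigma\rangle$, and $c_{j,m}=\prod_{i=1}^m\langle\Gamma_0^{m-i}e_j,E_0\sigma\rangle$. For $N\ge0$ let $\hat A=\hat A_N$ be the $q\times(q-1)$ matrix with $$\hat A_{ij}=-\delta_{ij}+\sum_{m=0}^{N}\langle\Gamma_0^me_j,E_i\sigma\rangle c_{j,m}\ \ (1\le i\le q-1,\ q\ne2),\qquad \hat A_{1j}=0\ \ (q=2),\qquad \hat A_{qj}=\sum_{m=0}^{N}c_{j,m},$$ for $1\le j\le q-1$. Let $b=(0,\dots,0,1)'\in\mathbb R^q$, let $\hat A^\dagger$ be the Moore–Penrose pseudo-inverse of $\hat A$, let $\hat\Phi=\hat A^\dagger b$, and put $$H_N(\mu)=\sum_{j=1}^{q-1}\sum_{m=0}^{N}\sum_{a=0}^{q-1}h_a(\Gamma_0^me_j)\,c_{j,m}\,\hat\Phi_j .$$ Let $\|\cdot\|_1$ be the matrix norm induced by the vector 1-norm (the maximal absolute column sum), and $$\gamma=\max_{1\le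 j\le q-1}\ \sup_{k\ge0}\ \sum_{a=0}^{q-1}\epsilon_a[\Gamma_0^ke_j]_a .$$ Then the limit defining $H(\mu)$ exists; for every $N$, $\hat\Phi$ is the unique least-squares solution of $\hat A\Phi=b$; $0<\gamma<1$; for every $N\ge0$, $$|H(\mu)-H_N(\mu)|\le q\,\frac{\gamma^{N+1}}{1-\gamma}\Bigl(1+\frac{q\|\hat A^\dagger\|_1}{1-\gamma}\Bigr);$$ and $|H(\mu)-H_N(\mu)|=O(\gamma^{N+1})$ as $N\to\infty$. Moreover, let $\epsilon=\max_{1\le a\le q-1}\epsilon_a$ and $r=1-(q-1)(p-\epsilon P)$. If $\epsilon<p$, then $0<r<1$, the same bound holds for every $N\ge0$ with $\gamma$ replaced by $r$, and $|H(\mu)-H_N(\mu)|=O(r^{N+1})$. -/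

import Mathlib

open MeasureTheory Filter Topology Asymptotics
open scoped Matrix BigOperators

namespace NoisyMarkov

noncomputable section

/-! ### Linear algebra: pseudo-inverse, least squares, the matrix 1-norm -/

section LinearAlgebra

variable {m n : Type*} [Fintype m] [Fintype n]

/-- `B` is a Moore-Penrose inverse of the real matrix `A` (the four Penrose equations). -/
structure IsMoorePenrose (A : Matrix m n ℝ) (B : Matrix n m ℝ) : Prop where
  mul_mul_left : A * B * A = A
  mul_mul_right : B * A * B = B
  symm_left : (A * B)ᵀ = A * B
  symm_right : (B * A)ᵀ = B * A

theorem IsMoorePenrose.unique {A : Matrix m n ℝ} {B C : Matrix n m ℝ}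
    (hB : IsMoorePenrose A B) (hC : IsMoorePenrose A C) : B = C := by
  have h1 : A * B = A * C := by
    have h : (A * B)ᵀ = (A * C * (A * B))ᵀ := by
      rw [← Matrix.mul_assoc, hC.mul_mul_left]
    rw [Matrix.transpose_mul (A * C), hB.symm_left, hC.symm_left, ← Matrix.mul_assoc,
      hB.mul_mul_left] at h
    exact h
  have h2 : B * A = C * A := by
    have h : (B * A)ᵀ = (B * A * (C * A))ᵀ := by
      rw [Matrix.mul_assoc, ← Matrix.mul_assoc A C A, hC.mul_mul_left]
    rw [Matrix.transpose_mul (B * A), hB.symm_right, hC.symm_right, Matrix.mul_assoc,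
      ← Matrix.mul_assoc A B A, hB.mul_mul_left] at h
    exact h
  calc B = B * A * B := hB.mul_mul_right.symm
    _ = C * A * C := by rw [h2, Matrix.mul_assoc, h1, ← Matrix.mul_assoc]
    _ = C := hC.mul_mul_right

theorem exists_isMoorePenrose (A : Matrix m n ℝ) : ∃ B, IsMoorePenrose A B := by
  classical
  have hM : (Aᵀ * A).IsHermitian := by
    rw [Matrix.IsHermitian, Matrix.conjTranspose_eq_transpose_of_trivial]; simp
  obtain ⟨S, hS1, hS2, hS3, hS4⟩ : ∃ S : Matrix n n ℝ, Aᵀ * A * S * (Aᵀ * A) = Aᵀ * A ∧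
      S * (Aᵀ * A) * S = S ∧ S * (Aᵀ * A) = Aᵀ * A * S ∧ Sᵀ = S := by
    generalize Aᵀ * A = M at hM
    let d : n → ℝ := hM.eigenvalues
    let f := Unitary.conjStarAlgAut ℝ (Matrix n n ℝ) hM.eigenvectorUnitary
    have hs : M = f (Matrix.diagonal d) := hM.spectral_theorem
    refine ⟨f (Matrix.diagonal fun i => (d i)⁻¹), ?_, ?_, ?_, ?_⟩
    · rw [hs, ← map_mul, ← map_mul]; congr 1; simp
    · rw [hs, ← map_mul, ← map_mul]; congr 1
      simp only [Matrix.diagonal_mul_diagonal]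
      congr 1; funext i
      by_cases h : d i = 0 <;> simp [h]
    · rw [hs, ← map_mul, ← map_mul]; congr 1; simp [mul_comm]
    · rw [← Matrix.conjTranspose_eq_transpose_of_trivial, ← Matrix.star_eq_conjTranspose,
        ← map_star]
      congr 1
      simp [Matrix.star_eq_conjTranspose]
  have key : A * S * Aᵀ * A = A := by
    have h : A * (S * (Aᵀ * A) - 1) = 0 := by
      rw [← Matrix.conjTranspose_mul_self_eq_zero, Matrix.conjTranspose_eq_transpose_of_trivial,
        Matrix.transpose_mul, Matrix.mul_assoc, ← Matrix.mul_assoc Aᵀ, Matrix.mul_sub,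
        Matrix.mul_one, ← Matrix.mul_assoc (Aᵀ * A) S, hS1, sub_self, Matrix.mul_zero]
    rw [Matrix.mul_sub, Matrix.mul_one, sub_eq_zero] at h
    simpa only [Matrix.mul_assoc] using h
  refine ⟨S * Aᵀ, ⟨?_, ?_, ?_, ?_⟩⟩
  · simpa only [Matrix.mul_assoc] using key
  · have := congrArg (· * Aᵀ) hS2
    simpa only [Matrix.mul_assoc] using this
  · simp [Matrix.transpose_mul, hS4, Matrix.mul_assoc]
  · rw [Matrix.mul_assoc, Matrix.transpose_mul, hS4, Matrix.transpose_mul,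
      Matrix.transpose_transpose, hS3]

/-- The pseudo-inverse `A†` of a real matrix: the unique matrix satisfying the Penrose
equations. -/
def pinv (A : Matrix m n ℝ) : Matrix n m ℝ := (exists_isMoorePenrose A).choose

theorem pinv_spec (A : Matrix m n ℝ) : IsMoorePenrose A (pinv A) :=
  (exists_isMoorePenrose A).choose_spec

/-- `x` is a least-squares solution of `A x = b`: it minimises the Euclidean norm of the
residual. -/
def IsLeastSquaresSolution (A : Matrix m n ℝ) (b : m → ℝ) (x : n → ℝ) : Prop :=
  ∀ y : n → ℝ, ∑ i, ((A *ᵥ x) i - b i) ^ 2 ≤ ∑ i, ((A *ᵥ y) i - b i) ^ 2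

/-- The matrix 1-norm (the operator norm for the vector 1-norm): the maximal absolute column
sum. -/
def oneNorm (M : Matrix m n ℝ) : ℝ := ⨆ j, ∑ i, |M i j|

end LinearAlgebra

/-! ### The hidden Markov process and the entropy rate -/

section Source

variable {q : ℕ}

/-- `X` is a stationary Markov chain with transition matrix `E` (so `E b c` is the probability of
passing from `b` to `c`) and `Y` is its observation through the memoryless channel `R`, where
`R a b` is the probability of observing `a` when `b` is transmitted. -/
structure IsHiddenMarkovProcess (E R : Matrix (Fin q) (Fin q) ℝ) {Ω : Type*} [MeasurableSpace Ω]
    (P : Measure Ω) (X Y : ℤ → Ω → Fin q) : Prop where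
  measurable_source : ∀ i, Measurable (X i)
  measurable_observation : ∀ i, Measurable (Y i)
  stationary : ∀ (i : ℤ) (a : Fin q), P.real {ω | X i ω = a} = P.real {ω | X 0 ω = a}
  joint_law : ∀ (t : ℤ) (n : ℕ) (x y : Fin (n + 1) → Fin q),
    P.real {ω | ∀ k : Fin (n + 1), X (t + (k : ℕ)) ω = x k ∧ Y (t + (k : ℕ)) ω = y k} =
      P.real {ω | X t ω = x 0} * (∏ k : Fin n, E (x k.castSucc) (x k.succ)) *
        ∏ k : Fin (n + 1), R (y k) (x k)

/-- The joint Shannon entropy, in bits, of the coordinates `1, …, n` under a measure on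
`K^ℤ`, where `K = {0, …, q - 1}`. -/
def blockEntropy (μ : Measure (ℤ → Fin q)) (n : ℕ) : ℝ :=
  -∑ w : Fin n → Fin q,
    μ.real {ω | ∀ k : Fin n, ω ((k : ℕ) + 1) = w k} *
      Real.logb 2 (μ.real {ω | ∀ k : Fin n, ω ((k : ℕ) + 1) = w k})

/-- The entropy rate `H(μ) = lim S_n / n`. -/
def entropyRate (μ : Measure (ℤ → Fin q)) : ℝ :=
  limUnder atTop fun n : ℕ => blockEntropy μ n / n

end Source

/-! ### The noise model and the truncated entropy formula -/

section Model

variable {q : ℕ} [NeZero q]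

/-- The nonzero symbols `1, …, q - 1`. -/
abbrev NonzeroSymbol (q : ℕ) [NeZero q] : Type := {a : Fin q // a ≠ 0}

/-- The channel: `0` is received as `0`; a symbol `b ≠ 0` is received as `0` with probability
`ε b` and as `b` with probability `1 - ε b`. Row: received symbol; column: transmitted one. -/
def channel (ε : Fin q → ℝ) : Matrix (Fin q) (Fin q) ℝ := fun a b =>
  if b = 0 then (if a = 0 then 1 else 0)
  else if a = 0 then ε b
  else if a = b then 1 - ε b
  else 0

/-- `E_a = ∑_b R_{ab} F_b`, where `F_b` has the `b`-th row of `E` as its only nonzero row. -/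
def obsMatrix (E : Matrix (Fin q) (Fin q) ℝ) (ε : Fin q → ℝ) (a : Fin q) :
    Matrix (Fin q) (Fin q) ℝ := fun b c => channel ε a b * E b c

/-- `⟨ν, E_a σ⟩` with `σ` the all-ones vector. -/
def obsProb (E : Matrix (Fin q) (Fin q) ℝ) (ε : Fin q → ℝ) (a : Fin q) (ν : Fin q → ℝ) : ℝ :=
  ν ⬝ᵥ (obsMatrix E ε a *ᵥ 1)

/-- `Γ_a ν = E_a^* ν / ⟨ν, E_a σ⟩`, and `0` if the denominator vanishes (as `0⁻¹ = 0`). -/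
def gammaMap (E : Matrix (Fin q) (Fin q) ℝ) (ε : Fin q → ℝ) (a : Fin q) (ν : Fin q → ℝ) :
    Fin q → ℝ :=
  (obsProb E ε a ν)⁻¹ • ((obsMatrix E ε a)ᵀ *ᵥ ν)

/-- `Γ_0^m e_j`, where `e_j` is the `j`-th row of `E` (counted from `0`). -/
def orbit (E : Matrix (Fin q) (Fin q) ℝ) (ε : Fin q → ℝ) (j : Fin q) (m : ℕ) : Fin q → ℝ :=
  (gammaMap E ε 0)^[m] (E j)

/-- `h_a(w) = -⟨w, E_a σ⟩ log₂ ⟨w, E_a σ⟩`. -/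
def entropyTerm (E : Matrix (Fin q) (Fin q) ℝ) (ε : Fin q → ℝ) (a : Fin q) (w : Fin q → ℝ) : ℝ :=
  -(obsProb E ε a w * Real.logb 2 (obsProb E ε a w))

/-- `c_{j,m} = ∏_{i=1}^m ⟨Γ_0^{m-i} e_j, E_0 σ⟩`. -/
def coeff (E : Matrix (Fin q) (Fin q) ℝ) (ε : Fin q → ℝ) (j : Fin q) (m : ℕ) : ℝ :=
  ∏ i ∈ Finset.Icc 1 m, obsProb E ε 0 (orbit E ε j (m - i))

/-- The truncated matrix `Â`: the series defining the entries of `A` are cut after the term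
`m = N`. The first block of rows is indexed by the symbols `1, …, q - 1`; the last row (the single
element of `Unit`) is the normalisation row, number `q`. For `q = 2` the first block is zero. -/
def truncMatrix (E : Matrix (Fin q) (Fin q) ℝ) (ε : Fin q → ℝ) (N : ℕ) :
    Matrix (NonzeroSymbol q ⊕ Unit) (NonzeroSymbol q) ℝ :=
  Matrix.fromRows
    (fun i j => if q = 2 then 0 else
      -(if i = j then 1 else 0) +
        ∑ m ∈ Finset.range (N + 1), obsProb E ε i (orbit E ε j m) * coeff E ε j m)
    (fun _ j => ∑ m ∈ Finset.range (N + 1), coeff E ε j m)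

/-- `b = (0, …, 0, 1)`. -/
def rhs (q : ℕ) [NeZero q] : NonzeroSymbol q ⊕ Unit → ℝ := Sum.elim (fun _ => 0) (fun _ => 1)

/-- `Φ̂ = Â† b`. -/
def approxPhi (E : Matrix (Fin q) (Fin q) ℝ) (ε : Fin q → ℝ) (N : ℕ) : NonzeroSymbol q → ℝ :=
  pinv (truncMatrix E ε N) *ᵥ rhs q

/-- `H_N(μ)`. -/
def approxEntropy (E : Matrix (Fin q) (Fin q) ℝ) (ε : Fin q → ℝ) (N : ℕ) : ℝ :=
  ∑ j : NonzeroSymbol q, ∑ m ∈ Finset.range (N + 1), ∑ a : Fin q,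
    entropyTerm E ε a (orbit E ε j m) * coeff E ε j m * approxPhi E ε N j

/-- `γ = max_j sup_k ∑_a ε_a [Γ_0^k e_j]_a`. -/
def gammaConst (E : Matrix (Fin q) (Fin q) ℝ) (ε : Fin q → ℝ) : ℝ :=
  ⨆ j : NonzeroSymbol q, ⨆ k : ℕ, ∑ a : Fin q, ε a * orbit E ε j k a

/-- `p`, the smallest entry of `E`. -/
def minEntry (E : Matrix (Fin q) (Fin q) ℝ) : ℝ := ⨅ x : Fin q × Fin q, E x.1 x.2

/-- `P`, the largest entry of `E`. -/
def maxEntry (E : Matrix (Fin q) (Fin q) ℝ) : ℝ := ⨆ x : Fin q × Fin q, E x.1 x.2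

/-- `ε = max_{a ≠ 0} ε_a`. -/
def maxNoise (ε : Fin q → ℝ) : ℝ := ⨆ a : NonzeroSymbol q, ε a

/-- `r = 1 - (q - 1) (p - ε P)`. -/
def rConst (E : Matrix (Fin q) (Fin q) ℝ) (ε : Fin q → ℝ) : ℝ :=
  1 - ((q : ℝ) - 1) * (minEntry E - maxNoise ε * maxEntry E)

/-- The error bound `q x^{N+1} / (1 - x) · (1 + q ‖Â†‖₁ / (1 - x))`. -/
def errorBound (E : Matrix (Fin q) (Fin q) ℝ) (ε : Fin q → ℝ) (N : ℕ) (x : ℝ) : ℝ :=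
  q * (x ^ (N + 1) / (1 - x)) * (1 + q * oneNorm (pinv (truncMatrix E ε N)) / (1 - x))

end Model

end

end NoisyMarkov

/-!
A nonzero observation `j` reveals the hidden state, and a run of `m` zeros after it leads to the
predictive distribution `Γ_0^m e_j` with probability `c_{j,m}`. A stretch of observations is
therefore governed by its last nonzero symbol and by the number of zeros since then.

The argument works with unnormalised state vectors `π E_{w_1} ⋯ E_{w_n}` (`wordVec`), whose mass is
the probability of the word `w` (`IsHiddenMarkovProcess.measureReal_word`). For a homogeneous
functional `F`, splitting words at their last nonzero symbol and using the stationarity of `π` gives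
(`sum_comp_wordVec`)

  `∑_w F(π E_w) = F(π E_0^n) + ∑_{m<n} ∑_{j≠0} Φ_j F(e_j E_0^m)`,  `Φ_j = π_j (1 - ε_j)`.

Everything comes from three choices of `F`. Write `s_n` for the mass of `π E_0^n`.

* `F` the mass, and `F` the probability of observing `i`: these show that the exact vector `Φ`
  solves the truncated system up to a residual of 1-norm at most `2 s_{N+1}`
  (`sum_abs_residual_le`). As `Â` is injective, `Â† Â = 1` and `‖Φ - Φ̂‖₁ ≤ 2 ‖Â†‖₁ s_{N+1}`. The
  mass identity also bounds `s_n` by the tail `γ^n / (1 - γ)` (`silentProb_le`).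
* `F` the conditional entropy of the next symbol (`condEntropy`): the left-hand side is
  `S_{n+1} - S_n`, and the right-hand side converges to the series
  `∑_m ∑_j Φ_j c_{j,m} ∑_a h_a(Γ_0^m e_j)`. By Cesàro, `S_n / n` has the same limit. As
  `∑_a h_a ≤ q` on probability vectors, the tail of the series from `N + 1` on is at most
  `q s_{N+1}`.

For the `O(γ^{N+1})` estimate `‖Â†‖₁` has to stay bounded. The matrices `Â` converge to a matrix
with positive last row and, for `q ≠ 2`, with first block `B - 1`, where `B` is positive and
column-stochastic. By Perron's theorem this limit is injective (`exists_tendsto_truncMatrix`); for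
`q = 2` there is only one column and the last row suffices. Moreover the pseudo-inverse
is continuous there (`eventually_oneNorm_pinv_le`). Finally, the predictive distributions are convex
combinations of rows of `E`, so their entries lie between `p` and `P`; hence `γ < 1` and `γ ≤ r`,
and the bounds in terms of `r` follow from those in terms of `γ`.
-/

namespace NoisyMarkov

/-! ### Positive models -/

section Model

theorem minEntry_le {q : ℕ} (E : Matrix (Fin q) (Fin q) ℝ) (b c : Fin q) : minEntry E ≤ E b c :=
  ciInf_le (f := fun x : Fin q × Fin q => E x.1 x.2) (Set.finite_range _).bddBelow (b, c)

theorem le_maxEntry {q : ℕ} (E : Matrix (Fin q) (Fin q) ℝ) (b c : Fin q) : E b c ≤ maxEntry E :=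
  le_ciSup (f := fun x : Fin q × Fin q => E x.1 x.2) (Set.finite_range _).bddAbove (b, c)

variable {q : ℕ} [NeZero q] {E : Matrix (Fin q) (Fin q) ℝ} {ε : Fin q → ℝ}

/-- A positive transition matrix on at least two symbols with noise parameters `ε 0 = 1` and
`0 < ε a < 1` for `a ≠ 0`. Positivity is expressed through the smallest entry of `E`. -/
structure IsPositiveModel (E : Matrix (Fin q) (Fin q) ℝ) (ε : Fin q → ℝ) : Prop where
  two_le : 2 ≤ q
  row_sum : ∀ b, ∑ c, E b c = 1
  minEntry_pos : 0 < minEntry E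
  noise_zero : ε 0 = 1
  noise_pos : ∀ a, 0 < ε a
  noise_lt_one : ∀ a, a ≠ 0 → ε a < 1

theorem sum_eq_zero_add_sum_nonzeroSymbol (f : Fin q → ℝ) :
    ∑ a, f a = f 0 + ∑ j : NonzeroSymbol q, f j :=
  Fintype.sum_eq_add_sum_subtype_ne f 0

theorem le_maxNoise (ε : Fin q → ℝ) (a : NonzeroSymbol q) : ε a ≤ maxNoise ε :=
  le_ciSup (f := fun a : NonzeroSymbol q => ε a) (Set.finite_range _).bddAbove a

theorem sum_channel (ε : Fin q → ℝ) (b : Fin q) : ∑ a, channel ε a b = 1 := by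
  unfold channel
  by_cases hb : b = 0
  · simp [hb]
  · rw [sum_eq_zero_add_sum_nonzeroSymbol, Finset.sum_eq_single ⟨b, hb⟩]
    · simp [hb]
    · intro a _ ha
      have : (a : Fin q) ≠ b := fun h => ha (Subtype.ext h)
      simp [hb, a.2, this]
    · simp

theorem channel_nonzero (ε : Fin q → ℝ) {a : Fin q} (ha : a ≠ 0) (b : Fin q) :
    channel ε a b = if b = a then 1 - ε a else 0 := by
  unfold channel
  by_cases hb : b = 0
  · simp [hb, ha, ha.symm]
  · by_cases hab : a = b
    · subst hab; simp [ha]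
    · simp [ha, hb, hab, Ne.symm hab]

theorem vecMul_obsMatrix_apply (E : Matrix (Fin q) (Fin q) ℝ) (ε u : Fin q → ℝ) (a c : Fin q) :
    (u ᵥ* obsMatrix E ε a) c = ∑ b, u b * (channel ε a b * E b c) := rfl

/-- A nonzero observation `a` reveals the hidden state: the state vector becomes a multiple of the
row `e_a`. -/
theorem vecMul_obsMatrix_nonzero (E : Matrix (Fin q) (Fin q) ℝ) (ε u : Fin q → ℝ) {a : Fin q}
    (ha : a ≠ 0) : u ᵥ* obsMatrix E ε a = (u a * (1 - ε a)) • E a := by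
  ext c
  simp [Matrix.vecMul, dotProduct, obsMatrix, channel_nonzero ε ha, mul_assoc]

theorem obsProb_eq_sum_vecMul (E : Matrix (Fin q) (Fin q) ℝ) (ε u : Fin q → ℝ) (a : Fin q) :
    obsProb E ε a u = ∑ c, (u ᵥ* obsMatrix E ε a) c := by
  rw [obsProb, Matrix.dotProduct_mulVec, dotProduct_one]

theorem obsProb_smul (E : Matrix (Fin q) (Fin q) ℝ) (ε : Fin q → ℝ) (a : Fin q) (c : ℝ)
    (u : Fin q → ℝ) : obsProb E ε a (c • u) = c * obsProb E ε a u := by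
  rw [obsProb, smul_dotProduct, smul_eq_mul, obsProb]

namespace IsPositiveModel

variable (h : IsPositiveModel E ε)
include h

theorem entry_pos (b c : Fin q) : 0 < E b c := h.minEntry_pos.trans_le (minEntry_le E b c)

theorem noise_le_one (a : Fin q) : ε a ≤ 1 := by
  by_cases ha : a = 0
  · rw [ha, h.noise_zero]
  · exact (h.noise_lt_one a ha).le

theorem exists_nonzero : ∃ a : Fin q, a ≠ 0 :=
  ⟨⟨1, h.two_le⟩, fun hc => by simpa using congrArg Fin.val hc⟩

theorem nonempty_nonzeroSymbol : Nonempty (NonzeroSymbol q) :=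
  let ⟨a, ha⟩ := h.exists_nonzero
  ⟨⟨a, ha⟩⟩

theorem channel_zero (b : Fin q) : channel ε 0 b = ε b := by
  unfold channel
  by_cases hb : b = 0
  · simp [hb, h.noise_zero]
  · simp [hb]

theorem channel_nonneg (a b : Fin q) : 0 ≤ channel ε a b := by
  by_cases ha : a = 0
  · rw [ha, h.channel_zero]; exact (h.noise_pos b).le
  · rw [channel_nonzero ε ha]
    split_ifs
    · exact sub_nonneg.2 (h.noise_le_one a)
    · exact le_rfl

theorem obsProb_eq (u : Fin q → ℝ) (a : Fin q) :
    obsProb E ε a u = ∑ b, u b * channel ε a b := by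
  simp only [obsProb, dotProduct, Matrix.mulVec, obsMatrix, Pi.one_apply, mul_one,
    ← Finset.mul_sum, h.row_sum]

theorem obsProb_zero_eq (u : Fin q → ℝ) : obsProb E ε 0 u = ∑ b, ε b * u b := by
  rw [h.obsProb_eq]
  exact Finset.sum_congr rfl fun b _ => by rw [h.channel_zero, mul_comm]

theorem obsProb_nonzero_eq (u : Fin q → ℝ) {a : Fin q} (ha : a ≠ 0) :
    obsProb E ε a u = u a * (1 - ε a) := by
  rw [h.obsProb_eq]
  simp [channel_nonzero ε ha]

theorem sum_obsProb (u : Fin q → ℝ) : ∑ a, obsProb E ε a u = ∑ b, u b := by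
  simp only [h.obsProb_eq]
  rw [Finset.sum_comm]
  simp only [← Finset.mul_sum, sum_channel, mul_one]

theorem obsMatrix_nonneg (a b c : Fin q) : 0 ≤ obsMatrix E ε a b c :=
  mul_nonneg (h.channel_nonneg a b) (h.entry_pos b c).le

theorem vecMul_obsMatrix_nonneg {u : Fin q → ℝ} (hu : ∀ b, 0 ≤ u b) (a c : Fin q) :
    0 ≤ (u ᵥ* obsMatrix E ε a) c :=
  Finset.sum_nonneg (s := Finset.univ) (f := fun b => u b * obsMatrix E ε a b c)
    fun b _ => mul_nonneg (hu b) (h.obsMatrix_nonneg a b c)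

theorem obsProb_nonneg {u : Fin q → ℝ} (hu : ∀ b, 0 ≤ u b) (a : Fin q) :
    0 ≤ obsProb E ε a u := by
  rw [h.obsProb_eq]
  exact Finset.sum_nonneg fun b _ => mul_nonneg (hu b) (h.channel_nonneg a b)

theorem obsProb_le_sum {u : Fin q → ℝ} (hu : ∀ b, 0 ≤ u b) (a : Fin q) :
    obsProb E ε a u ≤ ∑ b, u b := by
  rw [← h.sum_obsProb]
  exact Finset.single_le_sum (f := fun a => obsProb E ε a u)
    (fun a _ => h.obsProb_nonneg hu a) (Finset.mem_univ a)

/-- After one step the state vector is a nonnegative combination of rows of `E`, so its normalised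
entries are at least the smallest entry of `E`. -/
theorem minEntry_mul_obsProb_le {u : Fin q → ℝ} (hu : ∀ b, 0 ≤ u b) (a c : Fin q) :
    minEntry E * obsProb E ε a u ≤ (u ᵥ* obsMatrix E ε a) c := by
  rw [h.obsProb_eq, Finset.mul_sum, vecMul_obsMatrix_apply]
  refine Finset.sum_le_sum fun b _ => ?_
  have := mul_le_mul_of_nonneg_left (minEntry_le E b c)
    (mul_nonneg (hu b) (h.channel_nonneg a b))
  linarith

theorem vecMul_obsMatrix_le {u : Fin q → ℝ} (hu : ∀ b, 0 ≤ u b) (a c : Fin q) :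
    (u ᵥ* obsMatrix E ε a) c ≤ maxEntry E * obsProb E ε a u := by
  rw [h.obsProb_eq, Finset.mul_sum, vecMul_obsMatrix_apply]
  refine Finset.sum_le_sum fun b _ => ?_
  have := mul_le_mul_of_nonneg_left (le_maxEntry E b c)
    (mul_nonneg (hu b) (h.channel_nonneg a b))
  linarith

theorem obsProb_zero_pos {u : Fin q → ℝ} (hu : ∀ b, 0 ≤ u b) (hsum : ∑ b, u b = 1) :
    0 < obsProb E ε 0 u := by
  rw [h.obsProb_zero_eq]
  obtain ⟨b, -, hb⟩ := Finset.exists_ne_zero_of_sum_ne_zero (hsum.trans_ne one_ne_zero)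
  exact Finset.sum_pos' (fun b _ => mul_nonneg (h.noise_pos b).le (hu b))
    ⟨b, Finset.mem_univ b, mul_pos (h.noise_pos b) ((hu b).lt_of_ne' hb)⟩

/-- If the normalised entries of `u` are at least the smallest entry of `E`, then observing `0`
shrinks the mass of `u` by a fixed factor. -/
theorem exists_contraction : ∃ ρ : ℝ, 0 ≤ ρ ∧ ρ < 1 ∧ ∀ u : Fin q → ℝ, (∀ b, 0 ≤ u b) →
    (∀ b, minEntry E * ∑ c, u c ≤ u b) → obsProb E ε 0 u ≤ ρ * ∑ c, u c := by
  obtain ⟨a, ha⟩ := h.exists_nonzero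
  have hε : 0 < 1 - ε a := sub_pos.2 (h.noise_lt_one a ha)
  have hp1 : minEntry E ≤ 1 := by
    rw [← h.row_sum 0]
    exact (minEntry_le E 0 0).trans (Finset.single_le_sum (f := fun c => E 0 c)
      (fun c _ => (h.entry_pos 0 c).le) (Finset.mem_univ 0))
  refine ⟨1 - minEntry E * (1 - ε a), ?_, ?_, fun u hu hmin => ?_⟩
  · exact sub_nonneg.2 (mul_le_one₀ hp1 hε.le (sub_le_self 1 (h.noise_pos a).le))
  · exact sub_lt_self 1 (mul_pos h.minEntry_pos hε)
  · have h1 := h.sum_obsProb u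
    rw [sum_eq_zero_add_sum_nonzeroSymbol] at h1
    have h2 (i : NonzeroSymbol q) : obsProb E ε i u ≤ ∑ j : NonzeroSymbol q, obsProb E ε j u :=
      Finset.single_le_sum (f := fun j : NonzeroSymbol q => obsProb E ε j u)
        (fun j _ => h.obsProb_nonneg hu j.1) (Finset.mem_univ i)
    have h2 := h2 ⟨a, ha⟩
    rw [h.obsProb_nonzero_eq u ha] at h2
    have h3 := mul_le_mul_of_nonneg_right (hmin a) hε.le
    linarith

end IsPositiveModel

/-! ### The orbits of the rows of `E` under repeated observation of `0` -/

theorem orbit_succ (E : Matrix (Fin q) (Fin q) ℝ) (ε : Fin q → ℝ) (j : Fin q) (m : ℕ) :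
    orbit E ε j (m + 1) =
      (obsProb E ε 0 (orbit E ε j m))⁻¹ • (orbit E ε j m ᵥ* obsMatrix E ε 0) := by
  rw [orbit, Function.iterate_succ_apply', gammaMap, Matrix.mulVec_transpose]
  rfl

theorem coeff_eq_prod_range (E : Matrix (Fin q) (Fin q) ℝ) (ε : Fin q → ℝ) (j : Fin q) (m : ℕ) :
    coeff E ε j m = ∏ l ∈ Finset.range m, obsProb E ε 0 (orbit E ε j l) := by
  rw [coeff, ← Finset.prod_range_reflect, ← Finset.Ico_succ_right_eq_Icc,
    Finset.prod_Ico_eq_prod_range]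
  refine Finset.prod_congr rfl fun i _ => ?_
  rw [Nat.sub_sub]

theorem coeff_zero (E : Matrix (Fin q) (Fin q) ℝ) (ε : Fin q → ℝ) (j : Fin q) :
    coeff E ε j 0 = 1 := by
  simp [coeff_eq_prod_range]

theorem coeff_succ (E : Matrix (Fin q) (Fin q) ℝ) (ε : Fin q → ℝ) (j : Fin q) (m : ℕ) :
    coeff E ε j (m + 1) = coeff E ε j m * obsProb E ε 0 (orbit E ε j m) := by
  simp [coeff_eq_prod_range, Finset.prod_range_succ]

namespace IsPositiveModel

variable (h : IsPositiveModel E ε)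
include h

theorem orbit_nonneg_and_sum (j : Fin q) (m : ℕ) :
    (∀ b, 0 ≤ orbit E ε j m b) ∧ ∑ b, orbit E ε j m b = 1 := by
  induction m with
  | zero => exact ⟨fun b => (h.entry_pos j b).le, h.row_sum j⟩
  | succ m ih =>
    have hpos := h.obsProb_zero_pos ih.1 ih.2
    rw [orbit_succ]
    refine ⟨fun b => mul_nonneg (inv_nonneg.2 hpos.le) (h.vecMul_obsMatrix_nonneg ih.1 0 b), ?_⟩
    simp only [Pi.smul_apply, smul_eq_mul]
    rw [← Finset.mul_sum, ← obsProb_eq_sum_vecMul, inv_mul_cancel₀ hpos.ne']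

theorem orbit_nonneg (j : Fin q) (m : ℕ) (b : Fin q) : 0 ≤ orbit E ε j m b :=
  (h.orbit_nonneg_and_sum j m).1 b

theorem sum_orbit (j : Fin q) (m : ℕ) : ∑ b, orbit E ε j m b = 1 :=
  (h.orbit_nonneg_and_sum j m).2

theorem obsProb_orbit_pos (j : Fin q) (m : ℕ) : 0 < obsProb E ε 0 (orbit E ε j m) :=
  h.obsProb_zero_pos (h.orbit_nonneg j m) (h.sum_orbit j m)

theorem minEntry_le_orbit (j : Fin q) (m : ℕ) (b : Fin q) : minEntry E ≤ orbit E ε j m b := by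
  cases m with
  | zero => exact minEntry_le E j b
  | succ m =>
    have hpos := h.obsProb_orbit_pos j m
    rw [orbit_succ, Pi.smul_apply, smul_eq_mul, le_inv_mul_iff₀ hpos, mul_comm]
    exact h.minEntry_mul_obsProb_le (h.orbit_nonneg j m) 0 b

theorem orbit_le_maxEntry (j : Fin q) (m : ℕ) (b : Fin q) : orbit E ε j m b ≤ maxEntry E := by
  cases m with
  | zero => exact le_maxEntry E j b
  | succ m =>
    have hpos := h.obsProb_orbit_pos j m
    rw [orbit_succ, Pi.smul_apply, smul_eq_mul, inv_mul_le_iff₀ hpos, mul_comm]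
    exact h.vecMul_obsMatrix_le (h.orbit_nonneg j m) 0 b

theorem coeff_pos (j : Fin q) (m : ℕ) : 0 < coeff E ε j m := by
  rw [coeff_eq_prod_range]
  exact Finset.prod_pos fun l _ => h.obsProb_orbit_pos j l

/-- `c_{j,m}` is the normalisation that `Γ_0^m e_j` removes from the unnormalised state vector. -/
theorem vecMul_obsMatrix_pow (j : Fin q) (m : ℕ) :
    E j ᵥ* obsMatrix E ε 0 ^ m = coeff E ε j m • orbit E ε j m := by
  induction m with
  | zero => simp [coeff_zero, orbit]
  | succ m ih =>
    rw [pow_succ, ← Matrix.vecMul_vecMul, ih, Matrix.smul_vecMul, orbit_succ, smul_smul, coeff_succ,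
      mul_assoc, mul_inv_cancel₀ (h.obsProb_orbit_pos j m).ne', mul_one]

/-- The next nonzero observation after `j` occurs within `n` steps with probability `1 - c_{j,n}`;
the sum over `m` telescopes. -/
theorem sum_obsProb_orbit_mul_coeff (j : Fin q) (n : ℕ) :
    ∑ i : NonzeroSymbol q, ∑ m ∈ Finset.range n, obsProb E ε i (orbit E ε j m) * coeff E ε j m =
      1 - coeff E ε j n := by
  rw [Finset.sum_comm, ← coeff_zero E ε j, ← Finset.sum_range_sub']
  refine Finset.sum_congr rfl fun m _ => ?_
  have := h.sum_obsProb (orbit E ε j m)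
  rw [sum_eq_zero_add_sum_nonzeroSymbol, h.sum_orbit] at this
  rw [← Finset.sum_mul, eq_sub_iff_add_eq'.2 this, coeff_succ]
  ring

/-! ### The decay constants -/

theorem obsProb_orbit_le (j : NonzeroSymbol q) (m : ℕ) :
    obsProb E ε 0 (orbit E ε j m) ≤ gammaConst E ε := by
  have hb : ∀ (j : Fin q) (k : ℕ), ∑ a, ε a * orbit E ε j k a ≤ 1 := fun j k => by
    rw [← h.obsProb_zero_eq, ← h.sum_orbit j k]
    exact h.obsProb_le_sum (h.orbit_nonneg j k) 0
  rw [h.obsProb_zero_eq]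
  refine (le_ciSup (f := fun k => ∑ a, ε a * orbit E ε j k a) ⟨1, ?_⟩ m).trans
    (le_ciSup (f := fun j : NonzeroSymbol q => ⨆ k, ∑ a, ε a * orbit E ε j k a)
      (Set.finite_range _).bddAbove j)
  rintro _ ⟨k, rfl⟩
  exact hb j k

theorem gammaConst_le {x : ℝ} (hx : ∀ (j : NonzeroSymbol q) (m : ℕ),
    obsProb E ε 0 (orbit E ε j m) ≤ x) : gammaConst E ε ≤ x := by
  have := h.nonempty_nonzeroSymbol
  refine ciSup_le fun j => ciSup_le fun k => ?_
  rw [← h.obsProb_zero_eq]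
  exact hx j k

theorem gammaConst_pos : 0 < gammaConst E ε :=
  let ⟨j⟩ := h.nonempty_nonzeroSymbol
  (h.obsProb_orbit_pos j 0).trans_le (h.obsProb_orbit_le j 0)

theorem gammaConst_lt_one : gammaConst E ε < 1 := by
  obtain ⟨ρ, -, hρ, H⟩ := h.exists_contraction
  refine (h.gammaConst_le fun j m => ?_).trans_lt hρ
  have := H (orbit E ε j m) (h.orbit_nonneg j m) fun b => by
    rw [h.sum_orbit, mul_one]; exact h.minEntry_le_orbit j m b
  rwa [h.sum_orbit, mul_one] at this

theorem coeff_le_pow (j : NonzeroSymbol q) (m : ℕ) : coeff E ε j m ≤ gammaConst E ε ^ m := by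
  rw [coeff_eq_prod_range]
  refine (Finset.prod_le_prod (fun l _ => (h.obsProb_orbit_pos j l).le)
    fun l _ => h.obsProb_orbit_le j l).trans_eq ?_
  simp

theorem maxNoise_pos : 0 < maxNoise ε :=
  let ⟨a⟩ := h.nonempty_nonzeroSymbol
  (h.noise_pos a).trans_le (le_maxNoise ε a)

theorem card_nonzeroSymbol : (Fintype.card (NonzeroSymbol q) : ℝ) = q - 1 := by
  have h1 : Fintype.card (NonzeroSymbol q) = q - 1 := by
    simp [Fintype.card_subtype_compl]
  rw [h1, Nat.cast_sub (one_le_two.trans h.two_le), Nat.cast_one]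

theorem gammaConst_le_rConst : gammaConst E ε ≤ rConst E ε := by
  refine h.gammaConst_le fun j m => ?_
  have hsum := h.sum_orbit j m
  rw [sum_eq_zero_add_sum_nonzeroSymbol] at hsum
  have hlow : ∑ _b : NonzeroSymbol q, minEntry E ≤ ∑ b : NonzeroSymbol q, orbit E ε j m b :=
    Finset.sum_le_sum fun b _ => h.minEntry_le_orbit j m b
  have hup : ∑ b : NonzeroSymbol q, ε b * orbit E ε j m b ≤
      ∑ _b : NonzeroSymbol q, maxNoise ε * maxEntry E :=
    Finset.sum_le_sum fun b _ => mul_le_mul (le_maxNoise ε b) (h.orbit_le_maxEntry j m b)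
      (h.orbit_nonneg j m b) h.maxNoise_pos.le
  rw [Finset.sum_const, Finset.card_univ, nsmul_eq_mul, h.card_nonzeroSymbol] at hlow hup
  rw [h.obsProb_zero_eq, sum_eq_zero_add_sum_nonzeroSymbol, h.noise_zero, rConst]
  linarith

theorem rConst_lt_one (hP : maxEntry E < 1) (hε : maxNoise ε < minEntry E) : rConst E ε < 1 := by
  have hq : (2 : ℝ) ≤ q := by exact_mod_cast h.two_le
  have : maxNoise ε * maxEntry E < minEntry E := by nlinarith [h.maxNoise_pos]
  have := mul_pos (a := (q : ℝ) - 1) (by linarith) (sub_pos.2 this)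
  rw [rConst]
  linarith

end IsPositiveModel

end Model

/-! ### Pseudo-inverses of injective matrices -/

section LinearAlgebra

variable {m n : Type*} [Fintype m] [Fintype n]

theorem transpose_mul_mul_pinv (A : Matrix m n ℝ) : Aᵀ * (A * pinv A) = Aᵀ := by
  rw [← (pinv_spec A).symm_left, ← Matrix.transpose_mul, (pinv_spec A).mul_mul_left]

theorem pinv_mul_self [DecidableEq n] {A : Matrix m n ℝ} (hA : ∀ x, A *ᵥ x = 0 → x = 0) :
    pinv A * A = 1 := by
  refine Matrix.ext_of_mulVec_single fun i => sub_eq_zero.1 (hA _ ?_)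
  rw [Matrix.mulVec_sub, Matrix.mulVec_mulVec, ← Matrix.mul_assoc, (pinv_spec A).mul_mul_left,
    Matrix.one_mulVec, sub_self]

/-- The residual `A A† b - b` is orthogonal to the range of `A`, so Pythagoras gives the
minimality of `A† b`, and uniqueness follows from injectivity. -/
theorem isLeastSquaresSolution_iff {A : Matrix m n ℝ} (hA : ∀ x, A *ᵥ x = 0 → x = 0)
    (b : m → ℝ) (x : n → ℝ) : IsLeastSquaresSolution A b x ↔ x = pinv A *ᵥ b := by
  set x₀ := pinv A *ᵥ b with hx₀
  have horth : Aᵀ *ᵥ (A *ᵥ x₀ - b) = 0 := by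
    rw [Matrix.mulVec_sub, hx₀, Matrix.mulVec_mulVec, Matrix.mulVec_mulVec, Matrix.mul_assoc,
      transpose_mul_mul_pinv, sub_self]
  have hpyth (y : n → ℝ) : ∑ i, ((A *ᵥ y) i - b i) ^ 2 =
      ∑ i, ((A *ᵥ x₀) i - b i) ^ 2 + ∑ i, (A *ᵥ (y - x₀)) i ^ 2 := by
    have hcross : (A *ᵥ (y - x₀)) ⬝ᵥ (A *ᵥ x₀ - b) = 0 := by
      rw [← Matrix.vecMul_transpose, ← Matrix.dotProduct_mulVec, horth, dotProduct_zero]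
    have hsplit : ∀ i, (A *ᵥ y) i = (A *ᵥ (y - x₀)) i + (A *ᵥ x₀) i := fun i => by
      rw [Matrix.mulVec_sub, Pi.sub_apply, sub_add_cancel]
    have h2 : ∑ i, ((A *ᵥ y) i - b i) ^ 2 = ∑ i, ((A *ᵥ x₀) i - b i) ^ 2 +
        ∑ i, (A *ᵥ (y - x₀)) i ^ 2 + 2 * ((A *ᵥ (y - x₀)) ⬝ᵥ (A *ᵥ x₀ - b)) := by
      rw [dotProduct, Finset.mul_sum, ← Finset.sum_add_distrib, ← Finset.sum_add_distrib]
      refine Finset.sum_congr rfl fun i _ => ?_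
      rw [hsplit i, Pi.sub_apply]
      ring
    rw [h2, hcross, mul_zero, add_zero]
  constructor
  · intro hx
    have h1 := hx x₀
    rw [hpyth x] at h1
    have h2 : ∑ i, (A *ᵥ (x - x₀)) i ^ 2 = 0 :=
      le_antisymm (by linarith) (Finset.sum_nonneg fun i _ => sq_nonneg _)
    refine sub_eq_zero.1 (hA _ (funext fun i => ?_))
    exact pow_eq_zero_iff two_ne_zero |>.1
      ((Finset.sum_eq_zero_iff_of_nonneg fun i _ => sq_nonneg _).1 h2 i (Finset.mem_univ i))
  · rintro rfl y
    rw [hpyth y]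
    exact le_add_of_nonneg_right (Finset.sum_nonneg fun i _ => sq_nonneg _)

theorem oneNorm_nonneg {m n : Type*} [Fintype m] (M : Matrix m n ℝ) : 0 ≤ oneNorm M :=
  Real.iSup_nonneg fun _ => Finset.sum_nonneg fun _ _ => abs_nonneg _

theorem sum_abs_mulVec_le (M : Matrix m n ℝ) (x : n → ℝ) :
    ∑ i, |(M *ᵥ x) i| ≤ oneNorm M * ∑ j, |x j| := by
  calc ∑ i, |(M *ᵥ x) i| ≤ ∑ i, ∑ j, |M i j| * |x j| := by
        refine Finset.sum_le_sum fun i _ => (Finset.abs_sum_le_sum_abs _ _).trans_eq ?_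
        exact Finset.sum_congr rfl fun j _ => abs_mul _ _
    _ = ∑ j, (∑ i, |M i j|) * |x j| := by
        rw [Finset.sum_comm]; exact Finset.sum_congr rfl fun j _ => (Finset.sum_mul _ _ _).symm
    _ ≤ ∑ j, oneNorm M * |x j| := by
        refine Finset.sum_le_sum fun j _ => mul_le_mul_of_nonneg_right ?_ (abs_nonneg _)
        exact le_ciSup (f := fun j => ∑ i, |M i j|) (Set.finite_range _).bddAbove j
    _ = oneNorm M * ∑ j, |x j| := (Finset.mul_sum _ _ _).symm

theorem oneNorm_le_sum (M : Matrix m n ℝ) : oneNorm M ≤ ∑ j, ∑ i, |M i j| :=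
  Real.iSup_le (fun j => Finset.single_le_sum (f := fun j => ∑ i, |M i j|)
    (fun _ _ => Finset.sum_nonneg fun _ _ => abs_nonneg _) (Finset.mem_univ j))
    (Finset.sum_nonneg fun _ _ => Finset.sum_nonneg fun _ _ => abs_nonneg _)

/-- The pseudo-inverse is continuous at injective matrices, where it equals `(Aᵀ A)⁻¹ Aᵀ`; hence
its norm stays bounded along a sequence with an injective limit. -/
theorem eventually_oneNorm_pinv_le {A : ℕ → Matrix m n ℝ} {B : Matrix m n ℝ}
    (hAB : Tendsto A atTop (𝓝 B)) (hB : ∀ x, B *ᵥ x = 0 → x = 0) :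
    ∃ C, ∀ᶠ N in atTop, oneNorm (pinv (A N)) ≤ C := by
  classical
  have hdet : (Bᵀ * B).det ≠ 0 := fun h0 => by
    obtain ⟨v, hv, hv0⟩ := Matrix.exists_mulVec_eq_zero_iff.2 h0
    refine hv (hB v (dotProduct_self_eq_zero.1 ?_))
    rw [← Matrix.mulVec_mulVec] at hv0
    rw [Matrix.dotProduct_mulVec, ← Matrix.mulVec_transpose, hv0, zero_dotProduct]
  have hT : Tendsto (fun N => (A N)ᵀ * A N) atTop (𝓝 (Bᵀ * B)) :=
    ((continuous_id.matrix_transpose.matrix_mul continuous_id).tendsto B).comp hAB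
  have hdetT : Tendsto (fun N => ((A N)ᵀ * A N).det) atTop (𝓝 (Bᵀ * B).det) :=
    (continuous_id.matrix_det.tendsto _).comp hT
  have hF : Tendsto (fun N => ((A N)ᵀ * A N).det⁻¹ • (((A N)ᵀ * A N).adjugate * (A N)ᵀ)) atTop
      (𝓝 ((Bᵀ * B).det⁻¹ • ((Bᵀ * B).adjugate * Bᵀ))) :=
    (hdetT.inv₀ hdet).smul <|
      (((continuous_id.matrix_transpose.matrix_mul continuous_id).matrix_adjugate.matrix_mul
        continuous_id.matrix_transpose).tendsto B).comp hAB
  have hcont : Continuous fun M : Matrix n m ℝ => ∑ j, ∑ i, |M i j| :=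
    continuous_finsetSum _ fun j _ => continuous_finsetSum _ fun i _ =>
      (continuous_id.matrix_elem i j).abs
  have hS := (hcont.tendsto _).comp hF
  refine ⟨∑ j, ∑ i, |((Bᵀ * B).det⁻¹ • ((Bᵀ * B).adjugate * Bᵀ)) i j| + 1, ?_⟩
  filter_upwards [hdetT.eventually_ne hdet, hS.eventually_le_const (lt_add_one _)] with N h1 h2
  refine (oneNorm_le_sum _).trans ?_
  convert h2 using 1
  simp only [Function.comp_apply]
  congr! 4
  rw [← Matrix.smul_mul, ← Ring.inverse_eq_inv', ← Matrix.inv_def]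
  have hu : IsUnit ((A N)ᵀ * A N).det := isUnit_iff_ne_zero.2 h1
  have hpinv : (A N)ᵀ * A N * pinv (A N) = (A N)ᵀ := by
    rw [Matrix.mul_assoc, transpose_mul_mul_pinv]
  rw [← Matrix.nonsing_inv_mul_cancel_left _ (pinv (A N)) hu, hpinv]

/-- A nonnegative matrix with column sums smaller than `1` contracts the vector 1-norm, so it has
no nonzero fixed vector. -/
theorem eq_zero_of_mulVec_eq_of_sum_lt_one {B : Matrix n n ℝ} (hB : ∀ i j, 0 ≤ B i j)
    (hsum : ∀ j, ∑ i, B i j < 1) {x : n → ℝ} (hx : B *ᵥ x = x) : x = 0 := by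
  have h1 : ∑ i, |x i| ≤ ∑ j, (∑ i, B i j) * |x j| := by
    calc ∑ i, |x i| = ∑ i, |∑ j, B i j * x j| := by
          refine Finset.sum_congr rfl fun i _ => ?_
          conv_lhs => rw [← hx]
          rfl
      _ ≤ ∑ i, ∑ j, B i j * |x j| := by
          refine Finset.sum_le_sum fun i _ => (Finset.abs_sum_le_sum_abs _ _).trans_eq ?_
          exact Finset.sum_congr rfl fun j _ => by rw [abs_mul, abs_of_nonneg (hB i j)]
      _ = ∑ j, (∑ i, B i j) * |x j| := by
          rw [Finset.sum_comm]; exact Finset.sum_congr rfl fun j _ => (Finset.sum_mul _ _ _).symm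
  by_contra hne
  obtain ⟨j, hj⟩ := Function.ne_iff.1 hne
  refine h1.not_gt (Finset.sum_lt_sum (fun i _ => ?_) ⟨j, Finset.mem_univ j, ?_⟩)
  · exact mul_le_of_le_one_left (abs_nonneg _) (hsum i).le
  · exact mul_lt_of_lt_one_left (abs_pos.2 hj) (hsum j)

/-- A fixed vector of a positive column-stochastic matrix that has a positive entry is positive:
its positive part `y` satisfies `y ≤ B y`, and equality holds because both sides have the same
sum. -/
theorem pos_of_mulVec_eq {B : Matrix n n ℝ} (hB : ∀ i j, 0 < B i j) (hsum : ∀ j, ∑ i, B i j = 1)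
    {x : n → ℝ} (hx : B *ᵥ x = x) {j : n} (hj : 0 < x j) (i : n) : 0 < x i := by
  have hle : ∀ i, max (x i) 0 ≤ ∑ j, B i j * max (x j) 0 := fun i => by
    refine max_le ?_ (Finset.sum_nonneg fun j _ => mul_nonneg (hB i j).le (le_max_right _ _))
    conv_lhs => rw [← hx]
    exact Finset.sum_le_sum fun j _ => mul_le_mul_of_nonneg_left (le_max_left _ _) (hB i j).le
  have htot : ∑ i, max (x i) 0 = ∑ i, ∑ j, B i j * max (x j) 0 := by
    rw [Finset.sum_comm]
    simp only [← Finset.sum_mul, hsum, one_mul]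
  have heq := (Finset.sum_eq_sum_iff_of_le fun i _ => hle i).1 htot i (Finset.mem_univ i)
  have hpos : 0 < max (x i) 0 := by
    rw [heq]
    exact Finset.sum_pos' (fun k _ => mul_nonneg (hB i k).le (le_max_right _ _))
      ⟨j, Finset.mem_univ j, mul_pos (hB i j) (lt_max_of_lt_left hj)⟩
  exact (lt_max_iff.1 hpos).resolve_right (lt_irrefl 0)

/-- Perron's theorem for positive column-stochastic matrices, in the form that no nonzero fixed
vector is orthogonal to a positive vector. -/
theorem eq_zero_of_mulVec_eq_of_sum_eq_one {B : Matrix n n ℝ} (hB : ∀ i j, 0 < B i j)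
    (hsum : ∀ j, ∑ i, B i j = 1) {x w : n → ℝ} (hx : B *ᵥ x = x) (hw : ∀ j, 0 < w j)
    (hwx : w ⬝ᵥ x = 0) : x = 0 := by
  have key : ∀ y : n → ℝ, B *ᵥ y = y → w ⬝ᵥ y = 0 → ∀ j, y j ≤ 0 := fun y hy hwy j => by
    by_contra! hj
    have hpos : 0 < w ⬝ᵥ y := Finset.sum_pos
      (fun i _ => mul_pos (hw i) (pos_of_mulVec_eq hB hsum hy hj i)) ⟨j, Finset.mem_univ j⟩
    exact hpos.ne' hwy
  refine funext fun j => le_antisymm (key x hx hwx j) ?_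
  have := key (-x) (by rw [Matrix.mulVec_neg, hx]) (by rw [dotProduct_neg, hwx, neg_zero]) j
  simpa using this

end LinearAlgebra

/-! ### The truncated matrix and its limit -/

section Model

variable {q : ℕ} [NeZero q] {E : Matrix (Fin q) (Fin q) ℝ} {ε : Fin q → ℝ}

theorem truncMatrix_inl (N : ℕ) (i j : NonzeroSymbol q) :
    truncMatrix E ε N (Sum.inl i) j = if q = 2 then 0 else
      -(if i = j then 1 else 0) +
        ∑ m ∈ Finset.range (N + 1), obsProb E ε i (orbit E ε j m) * coeff E ε j m := rfl

theorem truncMatrix_mulVec_inl (hq : q ≠ 2) (N : ℕ) (x : NonzeroSymbol q → ℝ)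
    (i : NonzeroSymbol q) : (truncMatrix E ε N *ᵥ x) (Sum.inl i) =
      ∑ j : NonzeroSymbol q, (∑ m ∈ Finset.range (N + 1),
        obsProb E ε i (orbit E ε j m) * coeff E ε j m) * x j - x i := by
  simp only [Matrix.mulVec, dotProduct, truncMatrix_inl, if_neg hq, add_mul,
    Finset.sum_add_distrib]
  simp only [neg_mul, ite_mul, one_mul, zero_mul, Finset.sum_neg_distrib, Finset.sum_ite_eq,
    Finset.mem_univ, if_true]
  ring

theorem truncMatrix_mulVec_inl_of_eq_two (hq : q = 2) (N : ℕ) (x : NonzeroSymbol q → ℝ)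
    (i : NonzeroSymbol q) : (truncMatrix E ε N *ᵥ x) (Sum.inl i) = 0 := by
  simp [Matrix.mulVec, dotProduct, truncMatrix_inl, hq]

theorem truncMatrix_mulVec_inr (N : ℕ) (x : NonzeroSymbol q → ℝ) (i : Unit) :
    (truncMatrix E ε N *ᵥ x) (Sum.inr i) =
      ∑ j : NonzeroSymbol q, (∑ m ∈ Finset.range (N + 1), coeff E ε j m) * x j := rfl

/-- For two symbols there is a single nonzero symbol, so one positive row is enough for injectivity:
the first block of `Â` is not needed. -/
theorem eq_zero_of_two {x w : NonzeroSymbol q → ℝ} (hq : q = 2) (hw : ∀ j, 0 < w j)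
    (hwx : w ⬝ᵥ x = 0) : x = 0 := by
  have hcard : Fintype.card (NonzeroSymbol q) ≤ 1 := by
    subst hq
    simp [Fintype.card_subtype_compl]
  have := Fintype.card_le_one_iff_subsingleton.1 hcard
  funext j
  rw [dotProduct, Fintype.sum_subsingleton _ j] at hwx
  exact (mul_eq_zero.1 hwx).resolve_left (hw j).ne'

namespace IsPositiveModel

variable (h : IsPositiveModel E ε)
include h

theorem truncMatrix_injective (N : ℕ) (x : NonzeroSymbol q → ℝ)
    (hx : truncMatrix E ε N *ᵥ x = 0) : x = 0 := by
  by_cases hq : q = 2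
  · refine eq_zero_of_two hq (w := fun j => ∑ m ∈ Finset.range (N + 1), coeff E ε j m)
      (fun j => Finset.sum_pos (fun m _ => h.coeff_pos j m) ⟨0, by simp⟩) ?_
    exact congrFun hx (Sum.inr ())
  · refine eq_zero_of_mulVec_eq_of_sum_lt_one (B := fun i j : NonzeroSymbol q =>
      ∑ m ∈ Finset.range (N + 1), obsProb E ε i (orbit E ε j m) * coeff E ε j m) ?_ ?_ ?_
    · exact fun i j => Finset.sum_nonneg fun m _ =>
        mul_nonneg (h.obsProb_nonneg (h.orbit_nonneg j m) i) (h.coeff_pos j m).le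
    · intro j
      rw [h.sum_obsProb_orbit_mul_coeff]
      exact sub_lt_self 1 (h.coeff_pos j _)
    · funext i
      have := congrFun hx (Sum.inl i)
      rw [truncMatrix_mulVec_inl hq] at this
      exact sub_eq_zero.1 this

theorem summable_coeff (j : NonzeroSymbol q) : Summable fun m => coeff E ε j m :=
  Summable.of_nonneg_of_le (fun m => (h.coeff_pos j m).le) (fun m => h.coeff_le_pow j m)
    (summable_geometric_of_lt_one h.gammaConst_pos.le h.gammaConst_lt_one)

theorem summable_obsProb_mul_coeff (i : Fin q) (j : NonzeroSymbol q) :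
    Summable fun m => obsProb E ε i (orbit E ε j m) * coeff E ε j m := by
  refine Summable.of_nonneg_of_le (fun m => mul_nonneg (h.obsProb_nonneg (h.orbit_nonneg j m) i)
    (h.coeff_pos j m).le) (fun m => ?_) (h.summable_coeff j)
  refine mul_le_of_le_one_left (h.coeff_pos j m).le ?_
  rw [← h.sum_orbit j m]
  exact h.obsProb_le_sum (h.orbit_nonneg j m) i

/-- The truncated matrices converge to the matrix with the untruncated series, which is injective:
for `q ≠ 2` its first block is `B - 1` with `B` positive and column-stochastic, and its last row is
positive. -/
theorem exists_tendsto_truncMatrix : ∃ A : Matrix (NonzeroSymbol q ⊕ Unit) (NonzeroSymbol q) ℝ,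
    Tendsto (truncMatrix E ε) atTop (𝓝 A) ∧ ∀ x, A *ᵥ x = 0 → x = 0 := by
  set B : Matrix (NonzeroSymbol q) (NonzeroSymbol q) ℝ := fun i j =>
    ∑' m, obsProb E ε i (orbit E ε j m) * coeff E ε j m with hB
  set w : NonzeroSymbol q → ℝ := fun j => ∑' m, coeff E ε j m with hw
  have hBlim (i j : NonzeroSymbol q) : Tendsto (fun N => ∑ m ∈ Finset.range (N + 1),
      obsProb E ε i (orbit E ε j m) * coeff E ε j m) atTop (𝓝 (B i j)) :=
    (h.summable_obsProb_mul_coeff i j).hasSum.tendsto_sum_nat.comp (tendsto_add_atTop_nat 1)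
  have hwlim (j : NonzeroSymbol q) : Tendsto (fun N => ∑ m ∈ Finset.range (N + 1),
      coeff E ε j m) atTop (𝓝 (w j)) :=
    (h.summable_coeff j).hasSum.tendsto_sum_nat.comp (tendsto_add_atTop_nat 1)
  have hwpos (j : NonzeroSymbol q) : 0 < w j :=
    (h.summable_coeff j).tsum_pos (fun m => (h.coeff_pos j m).le) 0 (h.coeff_pos j 0)
  have hBpos (i j : NonzeroSymbol q) : 0 < B i j := by
    refine (h.summable_obsProb_mul_coeff i j).tsum_pos (fun m => mul_nonneg
      (h.obsProb_nonneg (h.orbit_nonneg j m) i) (h.coeff_pos j m).le) 0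
      (mul_pos ?_ (h.coeff_pos j 0))
    rw [h.obsProb_nonzero_eq _ i.2]
    exact mul_pos (h.entry_pos j i) (sub_pos.2 (h.noise_lt_one i i.2))
  have hBsum (j : NonzeroSymbol q) : ∑ i, B i j = 1 := by
    refine tendsto_nhds_unique (tendsto_finsetSum _ fun i _ => hBlim i j) ?_
    simp only [h.sum_obsProb_orbit_mul_coeff]
    simpa using tendsto_const_nhds.sub
      ((h.summable_coeff j).tendsto_atTop_zero.comp (tendsto_add_atTop_nat 1))
  set A := Matrix.fromRows (Matrix.of fun i j =>
    if q = 2 then 0 else -(if i = j then 1 else 0) + B i j) (Matrix.of fun (_ : Unit) j => w j)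
  have hA (i j) : A (Sum.inl i) j = if q = 2 then 0 else -(if i = j then 1 else 0) + B i j := rfl
  refine ⟨A, ?_, fun x hx => ?_⟩
  · refine tendsto_pi_nhds.2 fun i => tendsto_pi_nhds.2 fun j => ?_
    rcases i with i | i
    · by_cases hq : q = 2
      · simp only [truncMatrix_inl, hA, if_pos hq, tendsto_const_nhds]
      · simp only [truncMatrix_inl, hA, if_neg hq]
        exact (hBlim i j).const_add _
    · exact hwlim j
  · have hwx : w ⬝ᵥ x = 0 := congrFun hx (Sum.inr ())
    by_cases hq : q = 2
    · exact eq_zero_of_two hq hwpos hwx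
    · refine eq_zero_of_mulVec_eq_of_sum_eq_one hBpos hBsum (funext fun i => ?_) hwpos hwx
      have := congrFun hx (Sum.inl i)
      simp only [Matrix.mulVec, dotProduct, hA, if_neg hq, add_mul, Finset.sum_add_distrib,
        neg_mul, ite_mul, one_mul, zero_mul, Finset.sum_neg_distrib, Finset.sum_ite_eq,
        Finset.mem_univ, if_true, Pi.zero_apply] at this
      exact (neg_add_eq_zero.1 this).symm

end IsPositiveModel

end Model

/-! ### Unnormalised state vectors and the renewal decomposition -/

section Words

variable {q : ℕ} [NeZero q] {E : Matrix (Fin q) (Fin q) ℝ} {ε : Fin q → ℝ}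

theorem sum_fin_succ_fun {α : Type*} [Fintype α] {n : ℕ} (f : (Fin (n + 1) → α) → ℝ) :
    ∑ w, f w = ∑ w : Fin n → α, ∑ a, f (Fin.snoc w a) := by
  rw [← (Fin.snocEquiv fun _ : Fin (n + 1) => α).sum_comp, Fintype.sum_prod_type, Finset.sum_comm]
  rfl

/-- `π E_{w_1} ⋯ E_{w_n}`: the entry at `c` is the probability that the first `n` observations are
`w` and that the next hidden state is `c`, when the initial state has law `π`. -/
def wordVec (E : Matrix (Fin q) (Fin q) ℝ) (ε π : Fin q → ℝ) :
    (n : ℕ) → (Fin n → Fin q) → Fin q → ℝ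
  | 0, _ => π
  | n + 1, w => wordVec E ε π n (fun k => w k.castSucc) ᵥ* obsMatrix E ε (w (Fin.last n))

theorem wordVec_snoc (E : Matrix (Fin q) (Fin q) ℝ) (ε π : Fin q → ℝ) (n : ℕ)
    (w : Fin n → Fin q) (a : Fin q) :
    wordVec E ε π (n + 1) (Fin.snoc w a : Fin (n + 1) → Fin q) =
      wordVec E ε π n w ᵥ* obsMatrix E ε a := by
  simp [wordVec]

theorem sum_vecMul_obsMatrix (E : Matrix (Fin q) (Fin q) ℝ) (ε u : Fin q → ℝ) :
    ∑ a, u ᵥ* obsMatrix E ε a = u ᵥ* E := by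
  have : ∑ a, obsMatrix E ε a = E := by
    ext b c
    simp only [Matrix.sum_apply, obsMatrix]
    rw [← Finset.sum_mul, sum_channel, one_mul]
  rw [← Matrix.vecMul_sum, this]

theorem sum_wordVec {π : Fin q → ℝ} (hπ : π ᵥ* E = π) (n : ℕ) :
    ∑ w, wordVec E ε π n w = π := by
  induction n with
  | zero => simp [wordVec]
  | succ n ih =>
    rw [← Equiv.sum_comp (Fin.snocEquiv fun _ : Fin (n + 1) => Fin q), Fintype.sum_prod_type,
      Finset.sum_comm]
    calc ∑ w, ∑ a, wordVec E ε π (n + 1) (Fin.snoc w a : Fin (n + 1) → Fin q)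
        = ∑ w, wordVec E ε π n w ᵥ* E := by
          refine Finset.sum_congr rfl fun w _ => ?_
          simp only [wordVec_snoc, sum_vecMul_obsMatrix]
      _ = π := by rw [← Matrix.sum_vecMul, ih, hπ]

/-- Sum over words, split at the last nonzero symbol `j`: the part of the word before it sums to the
stationary probability of observing `j`, and after it the state vector is that of `e_j` followed by
zeros. -/
theorem sum_comp_wordVec {π : Fin q → ℝ} (hπ : π ᵥ* E = π) (n : ℕ) (F : (Fin q → ℝ) → ℝ)
    (hF : ∀ (c : ℝ) u, F (c • u) = c * F u) :
    ∑ w, F (wordVec E ε π n w) = F (π ᵥ* obsMatrix E ε 0 ^ n) +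
      ∑ m ∈ Finset.range n, ∑ j : NonzeroSymbol q,
        π j * (1 - ε j) * F (E j ᵥ* obsMatrix E ε 0 ^ m) := by
  induction n generalizing F with
  | zero => simp [wordVec]
  | succ n ih =>
    have hstep : ∀ w : Fin n → Fin q, ∑ a, F (wordVec E ε π n w ᵥ* obsMatrix E ε a) =
        F (wordVec E ε π n w ᵥ* obsMatrix E ε 0) +
          ∑ j : NonzeroSymbol q, wordVec E ε π n w j * ((1 - ε j) * F (E j)) := fun w => by
      rw [sum_eq_zero_add_sum_nonzeroSymbol]
      congr 1
      refine Finset.sum_congr rfl fun j _ => ?_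
      rw [vecMul_obsMatrix_nonzero E ε _ j.2, hF, mul_assoc]
    have hlin (j : NonzeroSymbol q) :
        ∑ w, wordVec E ε π n w j * ((1 - ε j) * F (E j)) = π j * (1 - ε j) * F (E j) := by
      rw [← Finset.sum_mul, ← Finset.sum_apply, sum_wordVec hπ, mul_assoc]
    rw [sum_fin_succ_fun]
    simp only [wordVec_snoc, hstep]
    rw [Finset.sum_add_distrib, Finset.sum_comm (f := fun w (j : NonzeroSymbol q) => _),
      ih (fun u => F (u ᵥ* obsMatrix E ε 0)) (fun c u => by rw [Matrix.smul_vecMul, hF])]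
    simp only [hlin, Matrix.vecMul_vecMul, ← pow_succ]
    rw [Finset.sum_range_succ', pow_zero]
    simp only [Matrix.vecMul_one]
    ring

end Words

/-! ### The law of the observed process -/

section Law

variable {q : ℕ} [NeZero q] {E : Matrix (Fin q) (Fin q) ℝ} {ε : Fin q → ℝ}

/-- The forward recursion: the joint weight of states and observations, summed over all states but
the last. -/
theorem sum_joint_weight (E : Matrix (Fin q) (Fin q) ℝ) (ε π : Fin q → ℝ) (n : ℕ)
    (y : Fin (n + 1) → Fin q) (c : Fin q) :
    ∑ x : Fin n → Fin q, (π ((Fin.snoc x c : Fin (n + 1) → Fin q) 0) *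
      (∏ k : Fin n, E ((Fin.snoc x c : Fin (n + 1) → Fin q) k.castSucc)
        ((Fin.snoc x c : Fin (n + 1) → Fin q) k.succ)) *
      ∏ k : Fin (n + 1), channel ε (y k) ((Fin.snoc x c : Fin (n + 1) → Fin q) k)) =
    wordVec E ε π n (fun k => y k.castSucc) c * channel ε (y (Fin.last n)) c := by
  induction n generalizing c with
  | zero => simp [wordVec, Fin.snoc]
  | succ n ih =>
    rw [sum_fin_succ_fun, Finset.sum_comm]
    rw [wordVec, vecMul_obsMatrix_apply, Finset.sum_mul]
    refine Finset.sum_congr rfl fun b _ => ?_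
    have h1 := ih (fun k => y k.castSucc) b
    rw [← mul_assoc, ← h1, Finset.sum_mul, Finset.sum_mul]
    refine Finset.sum_congr rfl fun x _ => ?_
    rw [Fin.prod_univ_castSucc (n := n), Fin.prod_univ_castSucc (n := n + 1)]
    have h0 : (Fin.snoc (Fin.snoc x b : Fin (n + 1) → Fin q) c : Fin (n + 2) → Fin q) 0 =
        (Fin.snoc x b : Fin (n + 1) → Fin q) 0 := by
      rw [← Fin.castSucc_zero, Fin.snoc_castSucc (α := fun _ => Fin q)]
    simp only [h0, Fin.succ_castSucc, Fin.succ_last, Fin.snoc_castSucc (α := fun _ => Fin q),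
      Fin.snoc_last (α := fun _ => Fin q)]
    ring

theorem sum_measureReal_preimage {Ω α : Type*} [MeasurableSpace Ω] [Fintype α]
    [MeasurableSpace α] [MeasurableSingletonClass α] (P : Measure Ω) [IsFiniteMeasure P]
    {Z : Ω → α} (hZ : Measurable Z) {p : Ω → Prop} (hp : MeasurableSet {ω | p ω}) :
    ∑ a, P.real {ω | Z ω = a ∧ p ω} = P.real {ω | p ω} := by
  rw [← measureReal_biUnion_finset]
  · congr 1
    ext ω
    simp
  · intro a _ b _ hab
    refine Set.disjoint_left.2 fun ω ha hb => hab (ha.1.symm.trans hb.1)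
  · exact fun a _ => (hZ (measurableSet_singleton a)).inter hp

namespace IsHiddenMarkovProcess

variable {Ω : Type*} [MeasurableSpace Ω] {P : Measure Ω} [IsProbabilityMeasure P]
  {X Y : ℤ → Ω → Fin q}

theorem measurableSet_word {q : ℕ} {Y : ℤ → Ω → Fin q} (hY : ∀ i, Measurable (Y i)) (n : ℕ)
    (t : ℤ) (w : Fin n → Fin q) :
    MeasurableSet {ω | ∀ k : Fin n, Y (t + (k : ℕ)) ω = w k} := by
  rw [Set.ofPred_forall]
  exact MeasurableSet.iInter fun k => hY _ (measurableSet_singleton _)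

/-- The joint law of the observed word and the last of its hidden states. -/
theorem measureReal_state_word (hXY : IsHiddenMarkovProcess E (channel ε) P X Y) (n : ℕ) (t : ℤ)
    (w : Fin (n + 1) → Fin q) (c : Fin q) :
    P.real {ω | X (t + (n : ℕ)) ω = c ∧ ∀ k : Fin (n + 1), Y (t + (k : ℕ)) ω = w k} =
      wordVec E ε (fun a => P.real {ω | X 0 ω = a}) n (fun k => w k.castSucc) c *
        channel ε (w (Fin.last n)) c := by
  have hZ : Measurable fun ω (k : Fin n) => X (t + (k : ℕ)) ω :=
    measurable_pi_lambda _ fun k => hXY.measurable_source _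
  have hS : MeasurableSet {ω | X (t + (n : ℕ)) ω = c ∧
      ∀ k : Fin (n + 1), Y (t + (k : ℕ)) ω = w k} :=
    (hXY.measurable_source _ (measurableSet_singleton c)).inter
      (measurableSet_word hXY.measurable_observation _ t w)
  rw [← sum_joint_weight, ← sum_measureReal_preimage P hZ hS]
  refine Finset.sum_congr rfl fun x _ => ?_
  rw [← hXY.stationary t, ← hXY.joint_law]
  congr 1
  ext ω
  simp only [Set.mem_ofPred_eq, forall_and, funext_iff]
  rw [Fin.forall_fin_succ' (P := fun k : Fin (n + 1) =>
    X (t + (k : ℕ)) ω = (Fin.snoc x c : Fin (n + 1) → Fin q) k)]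
  simp only [Fin.snoc_castSucc (α := fun _ => Fin q), Fin.snoc_last (α := fun _ => Fin q),
    Fin.val_castSucc, Fin.val_last, and_assoc]

theorem measureReal_word (hE : IsPositiveModel E ε)
    (hXY : IsHiddenMarkovProcess E (channel ε) P X Y) (n : ℕ) (t : ℤ) (w : Fin n → Fin q) :
    P.real {ω | ∀ k : Fin n, Y (t + (k : ℕ)) ω = w k} =
      ∑ c, wordVec E ε (fun a => P.real {ω | X 0 ω = a}) n w c := by
  cases n with
  | zero =>
    have := sum_measureReal_preimage (p := fun _ => True) P (hXY.measurable_source 0) (by simp)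
    simpa [wordVec] using this.symm
  | succ n =>
    rw [← sum_measureReal_preimage P (hXY.measurable_source (t + (n : ℕ)))
      (measurableSet_word hXY.measurable_observation _ t w)]
    simp only [hXY.measureReal_state_word]
    rw [wordVec, ← obsProb_eq_sum_vecMul, hE.obsProb_eq]

/-- The law of a single state is stationary under `E`: sum the joint law of two observations and the
second state over the observations. -/
theorem vecMul_law (hXY : IsHiddenMarkovProcess E (channel ε) P X Y) :
    (fun a => P.real {ω | X 0 ω = a}) ᵥ* E = fun a => P.real {ω | X 0 ω = a} := by
  funext c
  have hW : Measurable fun ω (k : Fin 2) => Y (0 + (k : ℕ)) ω :=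
    measurable_pi_lambda _ fun k => hXY.measurable_observation _
  have hS : MeasurableSet {ω | X (0 + (1 : ℕ)) ω = c} :=
    hXY.measurable_source _ (measurableSet_singleton c)
  rw [← hXY.stationary (0 + (1 : ℕ)), ← sum_measureReal_preimage P hW hS,
    ← sum_vecMul_obsMatrix E ε]
  have hstep (w : Fin 2 → Fin q) : P.real {ω | (fun k : Fin 2 => Y (0 + (k : ℕ)) ω) = w ∧
      X (0 + (1 : ℕ)) ω = c} = wordVec E ε (fun a => P.real {ω | X 0 ω = a}) 1
        (fun k => w k.castSucc) c * channel ε (w (Fin.last 1)) c := by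
    rw [← hXY.measureReal_state_word]
    congr 1
    ext ω
    simp only [Set.mem_ofPred_eq, funext_iff]
    exact and_comm
  simp only [hstep]
  rw [sum_fin_succ_fun]
  simp only [Fin.snoc_castSucc (α := fun _ => Fin q), Fin.snoc_last (α := fun _ => Fin q)]
  simp only [← Finset.mul_sum, sum_channel, mul_one]
  rw [sum_fin_succ_fun]
  simp only [wordVec_snoc, Finset.sum_apply]
  simp [wordVec]

end IsHiddenMarkovProcess

end Law

/-! ### Conditional entropy of the next observation -/

section Entropy

theorem neg_mul_logb_eq (x : ℝ) : -(x * Real.logb 2 x) = Real.negMulLog x / Real.log 2 := by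
  rw [Real.negMulLog, Real.logb]; ring

/-- No hypothesis is needed: the junk value of `logb` at `0` is always multiplied by `0`. -/
theorem neg_mul_logb_mul (c x : ℝ) : -(c * x * Real.logb 2 (c * x)) =
    c * -(x * Real.logb 2 x) - x * (c * Real.logb 2 c) := by
  rw [neg_mul_logb_eq, Real.negMulLog_mul]
  simp only [Real.negMulLog, Real.logb]
  ring

theorem neg_mul_logb_nonneg {x : ℝ} (h0 : 0 ≤ x) (h1 : x ≤ 1) : 0 ≤ -(x * Real.logb 2 x) := by
  rw [neg_mul_logb_eq]
  exact div_nonneg (Real.negMulLog_nonneg h0 h1) (Real.log_nonneg one_le_two)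

/-- The tangent to `-log` at `1/2` gives `-x log x ≤ 1/2 - x + x log 2 ≤ 1/2 ≤ log 2`. -/
theorem neg_mul_logb_le_one {x : ℝ} (h0 : 0 ≤ x) : -(x * Real.logb 2 x) ≤ 1 := by
  have hlog := Real.log_two_gt_d9
  have hlog' := Real.log_two_lt_d9
  rw [neg_mul_logb_eq, div_le_one (by linarith)]
  rcases h0.eq_or_lt with rfl | hx
  · simp only [Real.negMulLog_zero]; linarith
  · have h1 := Real.log_le_sub_one_of_pos (x := (2 * x)⁻¹) (by positivity)
    rw [Real.log_inv, Real.log_mul two_ne_zero hx.ne'] at h1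
    have h2 := mul_le_mul_of_nonneg_left h1 hx.le
    have h3 : x * ((2 * x)⁻¹ - 1) = 1 / 2 - x := by field_simp
    rw [Real.negMulLog]
    nlinarith

variable {q : ℕ} [NeZero q] {E : Matrix (Fin q) (Fin q) ℝ} {ε : Fin q → ℝ}

/-- The contribution of the unnormalised state vector `u` to the conditional entropy of the next
observation: the mass of `u` times the entropy of the observation from the normalised state. It is
written without the normalisation, so that it also makes sense when `u` has mass `0`. -/
noncomputable def condEntropy (E : Matrix (Fin q) (Fin q) ℝ) (ε u : Fin q → ℝ) : ℝ :=
  ∑ a, entropyTerm E ε a u - -((∑ c, u c) * Real.logb 2 (∑ c, u c))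

namespace IsPositiveModel

variable (h : IsPositiveModel E ε)
include h

theorem condEntropy_smul (c : ℝ) (u : Fin q → ℝ) :
    condEntropy E ε (c • u) = c * condEntropy E ε u := by
  have hs : ∑ b, (c • u) b = c * ∑ b, u b := by
    rw [Finset.mul_sum]; rfl
  simp only [condEntropy, entropyTerm, obsProb_smul, hs, neg_mul_logb_mul]
  rw [Finset.sum_sub_distrib, ← Finset.mul_sum, ← Finset.sum_mul, h.sum_obsProb]
  ring

omit h in
theorem condEntropy_of_sum_eq_one {u : Fin q → ℝ} (hu : ∑ b, u b = 1) :
    condEntropy E ε u = ∑ a, entropyTerm E ε a u := by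
  simp [condEntropy, hu]

theorem sum_entropyTerm_nonneg {u : Fin q → ℝ} (hu : ∀ b, 0 ≤ u b) (hsum : ∑ b, u b = 1) :
    0 ≤ ∑ a, entropyTerm E ε a u :=
  Finset.sum_nonneg fun a _ => neg_mul_logb_nonneg (h.obsProb_nonneg hu a)
    (hsum ▸ h.obsProb_le_sum hu a)

theorem sum_entropyTerm_le {u : Fin q → ℝ} (hu : ∀ b, 0 ≤ u b) :
    ∑ a, entropyTerm E ε a u ≤ q := by
  refine (Finset.sum_le_sum fun a _ => neg_mul_logb_le_one (h.obsProb_nonneg hu a)).trans_eq ?_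
  simp

theorem condEntropy_mem_Icc {u : Fin q → ℝ} (hu : ∀ b, 0 ≤ u b) :
    condEntropy E ε u ∈ Set.Icc 0 (q * ∑ b, u b) := by
  rcases (Finset.sum_nonneg fun b _ => hu b : 0 ≤ ∑ b, u b).eq_or_lt with h0 | hpos
  · have : u = 0 := funext fun b =>
      (Finset.sum_eq_zero_iff_of_nonneg fun b _ => hu b).1 h0.symm b (Finset.mem_univ b)
    simp [this, condEntropy, entropyTerm, obsProb]
  · set s := ∑ b, u b with hs
    have hv : ∀ b, 0 ≤ (s⁻¹ • u) b := fun b => mul_nonneg (inv_nonneg.2 hpos.le) (hu b)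
    have hv1 : ∑ b, (s⁻¹ • u) b = 1 := by
      simp only [Pi.smul_apply, smul_eq_mul]
      rw [← Finset.mul_sum, ← hs, inv_mul_cancel₀ hpos.ne']
    have hu' : u = s • s⁻¹ • u := by rw [smul_inv_smul₀ hpos.ne']
    rw [hu', h.condEntropy_smul, condEntropy_of_sum_eq_one hv1, mul_comm (q : ℝ)]
    exact ⟨mul_nonneg hpos.le (h.sum_entropyTerm_nonneg hv hv1),
      mul_le_mul_of_nonneg_left (h.sum_entropyTerm_le hv) hpos.le⟩

/-- The state `e_j` followed by `m` zeros has mass `c_{j,m}` and normalisation `Γ_0^m e_j`. -/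
theorem condEntropy_row (j : Fin q) (m : ℕ) : condEntropy E ε (E j ᵥ* obsMatrix E ε 0 ^ m) =
    (∑ a, entropyTerm E ε a (orbit E ε j m)) * coeff E ε j m := by
  rw [h.vecMul_obsMatrix_pow, h.condEntropy_smul, condEntropy_of_sum_eq_one (h.sum_orbit j m),
    mul_comm]

end IsPositiveModel

end Entropy

/-! ### The stationary source -/

section Stationary

variable {q : ℕ} [NeZero q] {E : Matrix (Fin q) (Fin q) ℝ} {ε π : Fin q → ℝ}

/-- `π` is a probability vector fixed by `E`. -/
structure IsStationaryLaw (E : Matrix (Fin q) (Fin q) ℝ) (π : Fin q → ℝ) : Prop where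
  nonneg : ∀ b, 0 ≤ π b
  sum_eq_one : ∑ b, π b = 1
  vecMul_eq : π ᵥ* E = π

/-- The probability that the first `k` observations are all `0`. -/
noncomputable def silentProb (E : Matrix (Fin q) (Fin q) ℝ) (ε π : Fin q → ℝ) (k : ℕ) : ℝ :=
  ∑ c, (π ᵥ* obsMatrix E ε 0 ^ k) c

/-- `Φ_j`, the stationary probability of observing the nonzero symbol `j`. -/
def emissionProb (ε π : Fin q → ℝ) (j : NonzeroSymbol q) : ℝ := π j * (1 - ε j)

/-- The contribution to the entropy rate of the times at which the last nonzero observation was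
made `m + 1` steps ago. -/
noncomputable def runEntropy (E : Matrix (Fin q) (Fin q) ℝ) (ε π : Fin q → ℝ) (m : ℕ) : ℝ :=
  ∑ j : NonzeroSymbol q, emissionProb ε π j *
    ((∑ a, entropyTerm E ε a (orbit E ε j m)) * coeff E ε j m)

variable (h : IsPositiveModel E ε) (hπ : IsStationaryLaw E π)
include h hπ

theorem emissionProb_nonneg (j : NonzeroSymbol q) : 0 ≤ emissionProb ε π j :=
  mul_nonneg (hπ.nonneg j) (sub_nonneg.2 (h.noise_le_one j))

theorem sum_emissionProb_le_one : ∑ j, emissionProb ε π j ≤ 1 := by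
  rw [← hπ.sum_eq_one, sum_eq_zero_add_sum_nonzeroSymbol]
  refine le_add_of_nonneg_of_le (hπ.nonneg 0) (Finset.sum_le_sum fun j _ => ?_)
  exact mul_le_of_le_one_right (hπ.nonneg j) (sub_le_self 1 (h.noise_pos j).le)

theorem silentVec_nonneg (k : ℕ) (b : Fin q) : 0 ≤ (π ᵥ* obsMatrix E ε 0 ^ k) b := by
  induction k generalizing b with
  | zero => simpa using hπ.nonneg b
  | succ k ih =>
    rw [pow_succ, ← Matrix.vecMul_vecMul]
    exact h.vecMul_obsMatrix_nonneg ih 0 b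

omit h hπ in
theorem silentProb_succ (k : ℕ) :
    silentProb E ε π (k + 1) = obsProb E ε 0 (π ᵥ* obsMatrix E ε 0 ^ k) := by
  rw [obsProb_eq_sum_vecMul, silentProb, pow_succ, ← Matrix.vecMul_vecMul]

theorem silentProb_nonneg (k : ℕ) : 0 ≤ silentProb E ε π k :=
  Finset.sum_nonneg fun b _ => silentVec_nonneg h hπ k b

theorem tendsto_silentProb : Tendsto (silentProb E ε π) atTop (𝓝 0) := by
  obtain ⟨ρ, hρ0, hρ1, H⟩ := h.exists_contraction
  -- For `k = 0` the entries of `π` are at least the smallest entry of `E` because `π = π E`.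
  have hmin (k : ℕ) (b : Fin q) :
      minEntry E * ∑ c, (π ᵥ* obsMatrix E ε 0 ^ k) c ≤ (π ᵥ* obsMatrix E ε 0 ^ k) b := by
    cases k with
    | zero =>
      simp only [pow_zero, Matrix.vecMul_one, Finset.mul_sum]
      conv_rhs => rw [← hπ.vecMul_eq]
      refine Finset.sum_le_sum fun c _ => ?_
      rw [mul_comm]
      exact mul_le_mul_of_nonneg_left (minEntry_le E c b) (hπ.nonneg c)
    | succ k =>
      rw [pow_succ, ← Matrix.vecMul_vecMul, ← obsProb_eq_sum_vecMul]
      exact h.minEntry_mul_obsProb_le (silentVec_nonneg h hπ k) 0 b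
  have hle (k : ℕ) : silentProb E ε π k ≤ ρ ^ k := by
    induction k with
    | zero => simp [silentProb, hπ.sum_eq_one]
    | succ k ih =>
      rw [silentProb_succ, pow_succ']
      exact (H _ (silentVec_nonneg h hπ k) (hmin k)).trans (mul_le_mul_of_nonneg_left ih hρ0)
  exact squeeze_zero (silentProb_nonneg h hπ) hle (tendsto_pow_atTop_nhds_zero_of_lt_one hρ0 hρ1)

/-- Total probability over the position of the last nonzero observation. -/
theorem silentProb_add_sum (n : ℕ) : silentProb E ε π n +
    ∑ m ∈ Finset.range n, ∑ j, emissionProb ε π j * coeff E ε j m = 1 := by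
  have key := sum_comp_wordVec (ε := ε) hπ.vecMul_eq n (fun u => ∑ c, u c) fun c u => by
    rw [Finset.mul_sum]; rfl
  rw [Finset.sum_comm] at key
  simp only [← Finset.sum_apply, sum_wordVec hπ.vecMul_eq, hπ.sum_eq_one] at key
  rw [key]
  simp only [h.vecMul_obsMatrix_pow, Pi.smul_apply, smul_eq_mul, ← Finset.mul_sum, h.sum_orbit,
    mul_one, silentProb, emissionProb]

/-- The probability of observing `i`, split according to the last nonzero observation before. -/
theorem obsProb_silent_add_sum (n : ℕ) (i : NonzeroSymbol q) :
    obsProb E ε i (π ᵥ* obsMatrix E ε 0 ^ n) +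
      ∑ m ∈ Finset.range n, ∑ j : NonzeroSymbol q,
        emissionProb ε π j * (obsProb E ε i (orbit E ε j m) * coeff E ε j m) =
      emissionProb ε π i := by
  have key := sum_comp_wordVec (ε := ε) hπ.vecMul_eq n (obsProb E ε i) (obsProb_smul E ε i)
  have hlin : ∑ w, obsProb E ε i (wordVec E ε π n w) = emissionProb ε π i := by
    simp only [h.obsProb_nonzero_eq _ i.2]
    rw [← Finset.sum_mul, ← Finset.sum_apply, sum_wordVec hπ.vecMul_eq, emissionProb]
  rw [hlin] at key
  rw [key]
  simp only [h.vecMul_obsMatrix_pow, obsProb_smul, emissionProb, mul_comm (coeff _ _ _ _)]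

theorem silentProb_sub (n k : ℕ) (hnk : n ≤ k) :
    ∑ m ∈ Finset.Ico n k, ∑ j, emissionProb ε π j * coeff E ε j m =
      silentProb E ε π n - silentProb E ε π k := by
  rw [Finset.sum_Ico_eq_sub _ hnk]
  linarith [silentProb_add_sum h hπ n, silentProb_add_sum h hπ k]

/-- The constant `γ` only controls the runs of zeros that start at a nonzero symbol. A run of `n`
zeros seen from `π` is the union of these, over the position of the last nonzero symbol. -/
theorem silentProb_le (n : ℕ) :
    silentProb E ε π n ≤ gammaConst E ε ^ n / (1 - gammaConst E ε) := by
  set γ := gammaConst E ε with hγ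
  have hγ0 : 0 < γ := h.gammaConst_pos
  have hγ1 : γ < 1 := h.gammaConst_lt_one
  have hk (k : ℕ) (hnk : n ≤ k) : silentProb E ε π n ≤ γ ^ n / (1 - γ) + silentProb E ε π k := by
    rw [← sub_le_iff_le_add, ← silentProb_sub h hπ n k hnk]
    refine le_trans (Finset.sum_le_sum (g := fun m => γ ^ m) fun m _ => ?_)
      (geom_sum_Ico_le_of_lt_one hγ0.le hγ1)
    calc ∑ j, emissionProb ε π j * coeff E ε j m ≤ ∑ j, emissionProb ε π j * γ ^ m :=
          Finset.sum_le_sum fun j _ =>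
            mul_le_mul_of_nonneg_left (h.coeff_le_pow j m) (emissionProb_nonneg h hπ j)
      _ ≤ γ ^ m := by
          rw [← Finset.sum_mul]
          exact mul_le_of_le_one_left (pow_nonneg hγ0.le m) (sum_emissionProb_le_one h hπ)
  have hlim := (tendsto_silentProb h hπ).const_add (γ ^ n / (1 - γ))
  rw [add_zero] at hlim
  exact ge_of_tendsto hlim (eventually_atTop.2 ⟨n, hk⟩)

theorem runEntropy_mem_Icc (m : ℕ) : runEntropy E ε π m ∈
    Set.Icc 0 (q * ∑ j, emissionProb ε π j * coeff E ε j m) := by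
  constructor
  · exact Finset.sum_nonneg fun j _ => mul_nonneg (emissionProb_nonneg h hπ j) (mul_nonneg
      (h.sum_entropyTerm_nonneg (h.orbit_nonneg j m) (h.sum_orbit j m)) (h.coeff_pos j m).le)
  · rw [Finset.mul_sum]
    refine Finset.sum_le_sum fun j _ => ?_
    rw [mul_left_comm (q : ℝ)]
    exact mul_le_mul_of_nonneg_left (mul_le_mul_of_nonneg_right
      (h.sum_entropyTerm_le (h.orbit_nonneg j m)) (h.coeff_pos j m).le) (emissionProb_nonneg h hπ j)

theorem summable_runEntropy : Summable (runEntropy E ε π) := by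
  refine Summable.of_nonneg_of_le (fun m => (runEntropy_mem_Icc h hπ m).1)
    (fun m => (runEntropy_mem_Icc h hπ m).2) (Summable.mul_left _ ?_)
  exact summable_sum fun j _ => (h.summable_coeff j).mul_left _

/-- The conditional entropies of the next observation given the previous `n` converge. -/
theorem tendsto_sum_condEntropy : Tendsto (fun n => ∑ w, condEntropy E ε (wordVec E ε π n w))
    atTop (𝓝 (∑' m, runEntropy E ε π m)) := by
  have heq (n : ℕ) : ∑ w, condEntropy E ε (wordVec E ε π n w) =
      condEntropy E ε (π ᵥ* obsMatrix E ε 0 ^ n) + ∑ m ∈ Finset.range n, runEntropy E ε π m := by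
    rw [sum_comp_wordVec hπ.vecMul_eq n _ h.condEntropy_smul]
    simp only [h.condEntropy_row, runEntropy, emissionProb]
  have h0 : Tendsto (fun n => condEntropy E ε (π ᵥ* obsMatrix E ε 0 ^ n)) atTop (𝓝 0) := by
    refine squeeze_zero (fun n => (h.condEntropy_mem_Icc (silentVec_nonneg h hπ n)).1)
      (fun n => (h.condEntropy_mem_Icc (silentVec_nonneg h hπ n)).2) ?_
    simpa [silentProb] using (tendsto_silentProb h hπ).const_mul (q : ℝ)
  simp only [heq]
  simpa using h0.add (summable_runEntropy h hπ).hasSum.tendsto_sum_nat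

/-- The tail of the entropy series is dominated termwise by `q` times the tail of the total
probability, which telescopes. -/
theorem abs_tsum_runEntropy_sub_le (n : ℕ) :
    |∑' m, runEntropy E ε π m - ∑ m ∈ Finset.range n, runEntropy E ε π m| ≤
      q * silentProb E ε π n := by
  have hsum := summable_runEntropy h hπ
  rw [abs_of_nonneg (sub_nonneg.2 (hsum.sum_le_tsum _ fun m _ => (runEntropy_mem_Icc h hπ m).1))]
  refine le_of_tendsto (hsum.hasSum.tendsto_sum_nat.sub_const _)
    (eventually_atTop.2 ⟨n, fun k hk => ?_⟩)
  rw [← Finset.sum_Ico_eq_sub _ hk]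
  refine (Finset.sum_le_sum fun m _ => (runEntropy_mem_Icc h hπ m).2).trans ?_
  rw [← Finset.mul_sum, silentProb_sub h hπ n k hk]
  exact mul_le_mul_of_nonneg_left (sub_le_self _ (silentProb_nonneg h hπ k)) (Nat.cast_nonneg q)

/-- The exact emission probabilities solve the truncated system up to the probability of a run of
`N + 1` zeros. -/
theorem sum_abs_residual_le (N : ℕ) :
    ∑ i, |(truncMatrix E ε N *ᵥ emissionProb ε π - rhs q) i| ≤
      2 * silentProb E ε π (N + 1) := by
  have hs := silentProb_nonneg h hπ (N + 1)
  have hu := silentVec_nonneg h hπ (N + 1)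
  have hinl (i : NonzeroSymbol q) : |(truncMatrix E ε N *ᵥ emissionProb ε π - rhs q) (Sum.inl i)| ≤
      obsProb E ε i (π ᵥ* obsMatrix E ε 0 ^ (N + 1)) := by
    rw [Pi.sub_apply, rhs, Sum.elim_inl, sub_zero]
    by_cases hq : q = 2
    · rw [truncMatrix_mulVec_inl_of_eq_two hq, abs_zero]
      exact h.obsProb_nonneg hu i
    · rw [truncMatrix_mulVec_inl hq, ← obsProb_silent_add_sum h hπ (N + 1) i, Finset.sum_comm]
      simp only [Finset.sum_mul, mul_comm (emissionProb ε π _)]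
      rw [sub_add_cancel_right, abs_neg, abs_of_nonneg (h.obsProb_nonneg hu i)]
  have hinr : (truncMatrix E ε N *ᵥ emissionProb ε π - rhs q) (Sum.inr ()) =
      -silentProb E ε π (N + 1) := by
    rw [Pi.sub_apply, rhs, Sum.elim_inr, truncMatrix_mulVec_inr,
      ← silentProb_add_sum h hπ (N + 1), Finset.sum_comm]
    simp only [Finset.sum_mul, mul_comm (emissionProb ε π _)]
    ring
  have htot := h.sum_obsProb (π ᵥ* obsMatrix E ε 0 ^ (N + 1))
  rw [sum_eq_zero_add_sum_nonzeroSymbol, ← silentProb] at htot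
  have h0 := h.obsProb_nonneg hu 0
  have hinl' := Finset.sum_le_sum fun i (_ : i ∈ Finset.univ) => hinl i
  rw [Fintype.sum_sum_type, Finset.univ_unique (α := Unit), Finset.sum_singleton,
    PUnit.default_eq_unit, hinr, abs_neg, abs_of_nonneg hs]
  linarith

theorem sum_abs_emissionProb_sub_le (N : ℕ) :
    ∑ j, |emissionProb ε π j - approxPhi E ε N j| ≤
      oneNorm (pinv (truncMatrix E ε N)) * (2 * silentProb E ε π (N + 1)) := by
  have heq : emissionProb ε π - approxPhi E ε N =
      pinv (truncMatrix E ε N) *ᵥ (truncMatrix E ε N *ᵥ emissionProb ε π - rhs q) := by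
    rw [Matrix.mulVec_sub, Matrix.mulVec_mulVec, pinv_mul_self (h.truncMatrix_injective N),
      Matrix.one_mulVec, approxPhi]
  calc ∑ j, |emissionProb ε π j - approxPhi E ε N j|
      = ∑ j, |(emissionProb ε π - approxPhi E ε N) j| := rfl
    _ ≤ oneNorm (pinv (truncMatrix E ε N)) *
          ∑ i, |(truncMatrix E ε N *ᵥ emissionProb ε π - rhs q) i| := by
        rw [heq]; exact sum_abs_mulVec_le _ _
    _ ≤ _ := mul_le_mul_of_nonneg_left (sum_abs_residual_le h hπ N) (oneNorm_nonneg _)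

/-- The error splits into the tail of the series and the effect of replacing `Φ` by `Φ̂`. -/
theorem abs_sub_approxEntropy_le (N : ℕ) :
    |∑' m, runEntropy E ε π m - approxEntropy E ε N| ≤ errorBound E ε N (gammaConst E ε) := by
  set γ := gammaConst E ε with hγ
  have hγ0 : 0 < γ := h.gammaConst_pos
  have hγ1 : 0 < 1 - γ := sub_pos.2 h.gammaConst_lt_one
  have hq : (2 : ℝ) ≤ q := by exact_mod_cast h.two_le
  set B := oneNorm (pinv (truncMatrix E ε N)) with hB
  have hB0 : 0 ≤ B := oneNorm_nonneg _
  have hsecond : |∑ m ∈ Finset.range (N + 1), runEntropy E ε π m - approxEntropy E ε N| ≤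
      B * (2 * silentProb E ε π (N + 1)) * (q * (1 / (1 - γ))) := by
    have hdiff : ∑ m ∈ Finset.range (N + 1), runEntropy E ε π m - approxEntropy E ε N =
        ∑ j, (emissionProb ε π j - approxPhi E ε N j) * ∑ m ∈ Finset.range (N + 1),
          (∑ a, entropyTerm E ε a (orbit E ε j m)) * coeff E ε j m := by
      simp only [runEntropy, approxEntropy]
      rw [Finset.sum_comm, ← Finset.sum_sub_distrib]
      refine Finset.sum_congr rfl fun j _ => ?_
      rw [sub_mul, Finset.mul_sum, Finset.mul_sum]
      congr 1
      refine Finset.sum_congr rfl fun m _ => ?_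
      rw [← Finset.sum_mul, ← Finset.sum_mul, mul_comm]
    have hrow (j : NonzeroSymbol q) : |∑ m ∈ Finset.range (N + 1),
        (∑ a, entropyTerm E ε a (orbit E ε j m)) * coeff E ε j m| ≤ q * (1 / (1 - γ)) := by
      have hnn (m : ℕ) : 0 ≤ (∑ a, entropyTerm E ε a (orbit E ε j m)) * coeff E ε j m :=
        mul_nonneg (h.sum_entropyTerm_nonneg (h.orbit_nonneg j m) (h.sum_orbit j m))
          (h.coeff_pos j m).le
      rw [abs_of_nonneg (Finset.sum_nonneg fun m _ => hnn m)]
      calc ∑ m ∈ Finset.range (N + 1), (∑ a, entropyTerm E ε a (orbit E ε j m)) * coeff E ε j m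
          ≤ ∑ m ∈ Finset.range (N + 1), q * γ ^ m :=
            Finset.sum_le_sum fun m _ => mul_le_mul (h.sum_entropyTerm_le (h.orbit_nonneg j m))
              (h.coeff_le_pow j m) (h.coeff_pos j m).le (Nat.cast_nonneg q)
        _ ≤ q * (1 / (1 - γ)) := by
            rw [← Finset.mul_sum, Finset.range_eq_Ico, ← pow_zero γ]
            exact mul_le_mul_of_nonneg_left
              (geom_sum_Ico_le_of_lt_one hγ0.le h.gammaConst_lt_one) (Nat.cast_nonneg q)
    rw [hdiff]
    calc _ ≤ ∑ j, |emissionProb ε π j - approxPhi E ε N j| * (q * (1 / (1 - γ))) := by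
          refine (Finset.abs_sum_le_sum_abs _ _).trans (Finset.sum_le_sum fun j _ => ?_)
          rw [abs_mul]
          exact mul_le_mul_of_nonneg_left (hrow j) (abs_nonneg _)
      _ ≤ _ := by
          rw [← Finset.sum_mul]
          exact mul_le_mul_of_nonneg_right (sum_abs_emissionProb_sub_le h hπ N) (by positivity)
  have hs := silentProb_le h hπ (N + 1)
  set T := γ ^ (N + 1) / (1 - γ) with hT
  have hT0 : 0 ≤ T := by positivity
  calc |∑' m, runEntropy E ε π m - approxEntropy E ε N|
      ≤ q * silentProb E ε π (N + 1) +
          B * (2 * silentProb E ε π (N + 1)) * (q * (1 / (1 - γ))) :=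
        (abs_sub_le _ _ _).trans (add_le_add (abs_tsum_runEntropy_sub_le h hπ (N + 1)) hsecond)
    _ ≤ q * T + B * (q * T) * (q * (1 / (1 - γ))) := by
        have h2 : 2 * silentProb E ε π (N + 1) ≤ q * T :=
          mul_le_mul hq hs (silentProb_nonneg h hπ _) (Nat.cast_nonneg q)
        gcongr
    _ = errorBound E ε N γ := by
        rw [errorBound, ← hT, ← hB]
        ring

omit h hπ in
theorem errorBound_mono (N : ℕ) {x y : ℝ} (hx : 0 ≤ x) (hxy : x ≤ y) (hy : y < 1) :
    errorBound E ε N x ≤ errorBound E ε N y := by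
  have hy' : 0 < 1 - y := sub_pos.2 hy
  have hx' : 0 < 1 - x := by linarith
  have hy0 : 0 ≤ y := hx.trans hxy
  have := oneNorm_nonneg (pinv (truncMatrix E ε N))
  unfold errorBound
  gcongr

/-- The error bound depends on `N` also through `‖Â†‖₁`, which stays bounded because the limit of
the truncated matrices is injective. -/
theorem isBigO_sub_approxEntropy :
    (fun N => ∑' m, runEntropy E ε π m - approxEntropy E ε N) =O[atTop]
      fun N => gammaConst E ε ^ (N + 1) := by
  obtain ⟨A, hA, hinj⟩ := h.exists_tendsto_truncMatrix
  obtain ⟨C, hC⟩ := eventually_oneNorm_pinv_le hA hinj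
  set γ := gammaConst E ε with hγ
  have hγ0 : 0 < γ := h.gammaConst_pos
  have hγ1 : 0 < 1 - γ := sub_pos.2 h.gammaConst_lt_one
  refine IsBigO.of_bound (q / (1 - γ) * (1 + q * C / (1 - γ))) ?_
  filter_upwards [hC] with N hN
  rw [Real.norm_eq_abs, Real.norm_eq_abs, abs_of_nonneg (pow_nonneg hγ0.le _)]
  refine (abs_sub_approxEntropy_le h hπ N).trans ?_
  calc errorBound E ε N γ ≤ q * (γ ^ (N + 1) / (1 - γ)) * (1 + q * C / (1 - γ)) := by
        unfold errorBound
        gcongr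
    _ = _ := by ring

end Stationary

/-! ### The entropy rate -/

section Rate

variable {q : ℕ} [NeZero q] {E : Matrix (Fin q) (Fin q) ℝ} {ε : Fin q → ℝ}
  {Ω : Type*} [MeasurableSpace Ω] {P : Measure Ω} [IsProbabilityMeasure P] {X Y : ℤ → Ω → Fin q}

theorem IsHiddenMarkovProcess.isStationaryLaw
    (hXY : IsHiddenMarkovProcess E (channel ε) P X Y) :
    IsStationaryLaw E fun a => P.real {ω | X 0 ω = a} where
  nonneg _ := measureReal_nonneg
  sum_eq_one := by
    simpa using sum_measureReal_preimage (p := fun _ => True) P (hXY.measurable_source 0) (by simp)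
  vecMul_eq := hXY.vecMul_law

theorem IsHiddenMarkovProcess.blockEntropy_eq (h : IsPositiveModel E ε)
    (hXY : IsHiddenMarkovProcess E (channel ε) P X Y) (n : ℕ) :
    blockEntropy (P.map fun ω i => Y i ω) n =
      ∑ w, -((∑ c, wordVec E ε (fun a => P.real {ω | X 0 ω = a}) n w c) *
        Real.logb 2 (∑ c, wordVec E ε (fun a => P.real {ω | X 0 ω = a}) n w c)) := by
  have hY : Measurable fun ω i => Y i ω := measurable_pi_lambda _ hXY.measurable_observation
  rw [blockEntropy, ← Finset.sum_neg_distrib]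
  refine Finset.sum_congr rfl fun w _ => ?_
  have hw : (P.map fun ω i => Y i ω).real {ω | ∀ k : Fin n, ω ((k : ℕ) + 1) = w k} =
      ∑ c, wordVec E ε (fun a => P.real {ω | X 0 ω = a}) n w c := by
    rw [map_measureReal_apply hY, ← hXY.measureReal_word h n 1 w]
    · simp only [add_comm (1 : ℤ)]
      rfl
    · rw [Set.ofPred_forall]
      exact MeasurableSet.iInter fun k => measurable_pi_apply _ (measurableSet_singleton _)
  rw [hw]

/-- The chain rule: block entropies are sums of conditional entropies, so `S_n / n` is a Cesàro
mean of a convergent sequence. -/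
theorem IsHiddenMarkovProcess.tendsto_blockEntropy (h : IsPositiveModel E ε)
    (hXY : IsHiddenMarkovProcess E (channel ε) P X Y) :
    Tendsto (fun n : ℕ => blockEntropy (P.map fun ω i => Y i ω) n / n) atTop
      (𝓝 (∑' m, runEntropy E ε (fun a => P.real {ω | X 0 ω = a}) m)) := by
  have hπ := hXY.isStationaryLaw
  refine (tendsto_sum_condEntropy h hπ).cesaro.congr fun n => ?_
  rw [div_eq_inv_mul]
  congr 1
  have hstep (k : ℕ) :
      ∑ w, condEntropy E ε (wordVec E ε (fun a => P.real {ω | X 0 ω = a}) k w) =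
      blockEntropy (P.map fun ω i => Y i ω) (k + 1) -
        blockEntropy (P.map fun ω i => Y i ω) k := by
    simp only [hXY.blockEntropy_eq h, condEntropy, entropyTerm]
    rw [Finset.sum_sub_distrib, sum_fin_succ_fun (n := k)]
    simp only [wordVec_snoc, obsProb_eq_sum_vecMul]
  simp only [hstep]
  rw [Finset.sum_range_sub, hXY.blockEntropy_eq h 0]
  simp [wordVec, hπ.sum_eq_one]

end Rate

end NoisyMarkov

theorem mainTheorem2 {q : ℕ} [NeZero q] (E : Matrix (Fin q) (Fin q) ℝ) (ε : Fin q → ℝ)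
    (hE : E ∈ Matrix.rowStochastic ℝ (Fin q))
    (hp : 0 < NoisyMarkov.minEntry E) (hP : NoisyMarkov.maxEntry E < 1)
    (hε0 : ε 0 = 1) (hε : ∀ a : Fin q, a ≠ 0 → 0 < ε a ∧ ε a < 1)
    {Ω : Type*} [MeasurableSpace Ω] (P : Measure Ω) [IsProbabilityMeasure P]
    (X Y : ℤ → Ω → Fin q)
    (hXY : NoisyMarkov.IsHiddenMarkovProcess E (NoisyMarkov.channel ε) P X Y)
    (μ : Measure (ℤ → Fin q)) (hμ : μ = P.map (fun ω i => Y i ω)) :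
    Tendsto (fun n : ℕ => NoisyMarkov.blockEntropy μ n / n) atTop
        (𝓝 (NoisyMarkov.entropyRate μ)) ∧
    (∀ (N : ℕ) (x : NoisyMarkov.NonzeroSymbol q → ℝ),
      NoisyMarkov.IsLeastSquaresSolution (NoisyMarkov.truncMatrix E ε N) (NoisyMarkov.rhs q) x ↔
        x = NoisyMarkov.approxPhi E ε N) ∧
    (0 < NoisyMarkov.gammaConst E ε ∧ NoisyMarkov.gammaConst E ε < 1) ∧
    (∀ N : ℕ, |NoisyMarkov.entropyRate μ - NoisyMarkov.approxEntropy E ε N| ≤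
      NoisyMarkov.errorBound E ε N (NoisyMarkov.gammaConst E ε)) ∧
    (fun N : ℕ => NoisyMarkov.entropyRate μ - NoisyMarkov.approxEntropy E ε N) =O[atTop]
      (fun N : ℕ => NoisyMarkov.gammaConst E ε ^ (N + 1)) ∧
    (NoisyMarkov.maxNoise ε < NoisyMarkov.minEntry E →
      (0 < NoisyMarkov.rConst E ε ∧ NoisyMarkov.rConst E ε < 1) ∧
      (∀ N : ℕ, |NoisyMarkov.entropyRate μ - NoisyMarkov.approxEntropy E ε N| ≤
        NoisyMarkov.errorBound E ε N (NoisyMarkov.rConst E ε)) ∧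
      (fun N : ℕ => NoisyMarkov.entropyRate μ - NoisyMarkov.approxEntropy E ε N) =O[atTop]
        (fun N : ℕ => NoisyMarkov.rConst E ε ^ (N + 1))) := by
  have hrow : ∀ b, ∑ c, E b c = 1 := (Matrix.mem_rowStochastic_iff_sum.1 hE).2
  have hq : 2 ≤ q := by
    -- For `q = 1` the only entry of `E` is `1`, against `hP`.
    by_contra hlt
    obtain rfl : q = 1 := by have := NeZero.pos q; omega
    have h1 := hrow 0
    rw [Fin.sum_univ_one] at h1
    exact ((NoisyMarkov.le_maxEntry E 0 0).trans_lt hP).ne h1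
  have h : NoisyMarkov.IsPositiveModel E ε :=
    { two_le := hq
      row_sum := hrow
      minEntry_pos := hp
      noise_zero := hε0
      noise_pos := fun a => by
        by_cases ha : a = 0
        · rw [ha, hε0]; exact one_pos
        · exact (hε a ha).1
      noise_lt_one := fun a ha => (hε a ha).2 }
  have hπ := hXY.isStationaryLaw
  have hlim := hXY.tendsto_blockEntropy h
  rw [← hμ] at hlim
  have hrate : NoisyMarkov.entropyRate μ = _ := hlim.limUnder_eq
  rw [hrate]
  have hγ0 := h.gammaConst_pos
  have hγr := h.gammaConst_le_rConst
  have hO := NoisyMarkov.isBigO_sub_approxEntropy h hπ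
  refine ⟨hlim, fun N x => NoisyMarkov.isLeastSquaresSolution_iff (h.truncMatrix_injective N) _ x,
    ⟨hγ0, h.gammaConst_lt_one⟩, NoisyMarkov.abs_sub_approxEntropy_le h hπ, hO, fun hεp => ?_⟩
  have hr1 := h.rConst_lt_one hP hεp
  refine ⟨⟨hγ0.trans_le hγr, hr1⟩, fun N => (NoisyMarkov.abs_sub_approxEntropy_le h hπ N).trans
    (NoisyMarkov.errorBound_mono N hγ0.le hγr hr1), hO.trans (IsBigO.of_norm_le fun N => ?_)⟩
  rw [Real.norm_of_nonneg (pow_nonneg hγ0.le _)]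
  exact pow_le_pow_left₀ hγ0.le hγr _
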